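/- Let $p:\mathcal D\to\mathcal C$ be a functor; composition is written in diagrammatic order ($fg$ is $f$ followed by $g$). The *bifibrational calculus generated by $p$* is the following. Formulas $S\sqsubset A$ over the objects $A$ of $\mathcal C$ are generated inductively: $X\sqsubset A$ for $X\in\mathcal D$ with $p(X)=A$; $f_+S\sqsubset B$ for $S\sqsubset A$ and $f:A\to B$ in $\mathcal C$; $g^-T\sqsubset B$ for $g:B\to E$ in $\mathcal C$ and $T\sqsubset E$. Sequents are $S\vdash_h T$ with $S\sqsubset A$, $T\sqsubset B$, $h:A\to B$. Proofs are generated by an axiom $\delta:X\vdash_h Y$ for every $\delta:X\to Y$ in $\mathcal D$ with $p(\delta)=h$, and the four rules $$\frac{\alpha:S\vdash_{fg}T}{f\backslash_g\alpha:f_+S\vdash_g T}\qquad \frac{\alpha:S\vdash_{g}T}{\alpha\cdot f:S\vdash_{gf}f_+T}\qquad \frac{\alpha:S\vdash_{g}T}{f\cdot\alpha:f^-S\vdash_{fg}T}\qquad \frac{\alpha:S\vdash_{gf}T}{\alpha\,{}_g/f:S\vdash_g f^-T}.$$ *Permutation equivalence* $\sim$ is the smallest equivalence relation between proofs of the same sequent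 that is closed under the four rules and contains, whenever both sides are valid, $(f\cdot\alpha)\cdot h\sim f\cdot(\alpha\cdot h)$ for $\alpha$ over $g$; $(f\backslash_g\alpha)\cdot h\sim f\backslash_{gh}(\alpha\cdot h)$ for $\alpha$ over $fg$; $(f\cdot\alpha)\,{}_{fg}/h\sim f\cdot(\alpha\,{}_g/h)$ for $\alpha$ over $gh$; and $(f\backslash_{gh}\alpha)\,{}_g/h\sim f\backslash_g(\alpha\,{}_{fg}/h)$ for $\alpha$ over $fgh$. Suppose that the objects and the arrows of $\mathcal C$ and of $\mathcal D$ are coded by natural numbers, distinct objects and distinct parallel arrows having distinct codes, and that composition in $\mathcal C$ is computable on codes (by a partial recursive function defined at least on the codes of composable pairs). A proof is coded by its axiom $\delta$ and the list of its rule instances, labelled with their arrows and with the base arrows of the sequents (in particular with $p(\delta)$). Suppose further that one of the following holds. 1. $\mathcal C$ is locally finite (all homsets are finite), and a list of the codes of the arrows $A\to B$ can be computed from the codes of any two objects $A,B$ of $\mathcal C$. 2. $\mathcal C$ is factorization preordered (if $fg=fh$ and $gk=hk$, then $g=h$), and from the codes of the sides of any commuting square $xk=fy$ in $\mathcal C$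 one can compute whether there is a diagonal $l$ with $fl=x$ and $lk=y$ and, if so, the code of such an $l$. Then permutation equivalence of proofs is decidable: there is a single partial recursive function which, for all formulas $S,T$, all base arrows $f$ and any two proofs $\alpha_1,\alpha_2:S\vdash_f T$, is defined on the codes of $\alpha_1,\alpha_2$ and outputs true if $\alpha_1\sim\alpha_2$ and false otherwise. -/

import Mathlib

open CategoryTheory

universe v₁ v₂ u₁ u₂

namespace Bifibrational

/-! # The bifibrational calculus of a functor -/

section Calculus

variable {D : Type u₁} [Category.{v₁} D] {C : Type u₂} [Category.{v₂} C]

/-- Bifibrational formulas generated by `p`; `Frm p A` is the set of formulas `S` lying over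
(refining) the object `A` of the base category. -/
inductive Frm (p : D ⥤ C) : C → Type (max u₁ u₂ v₂)
  /-- The atomic formula of an object `X` with `p X = A`. -/
  | atom {A : C} (X : D) (e : p.obj X = A) : Frm p A
  /-- The push formula `f₊ S`. -/
  | push {A B : C} (f : A ⟶ B) (S : Frm p A) : Frm p B
  /-- The pull formula `g⁻ T`. -/
  | pull {B E : C} (g : B ⟶ E) (T : Frm p E) : Frm p B

/-- Proofs (closed, cut-free derivations) of the unary sequent `S ⊢_h T`.

Composition is in diagrammatic order. The base of the premise and the base of the conclusion of
a rule are separate indices, linked by an equation (so that no transport along associativity is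
needed); the equations are propositions, hence carry no information. -/
inductive Deriv (p : D ⥤ C) :
    {A B : C} → Frm p A → Frm p B → (A ⟶ B) → Type (max u₁ v₁ u₂ v₂)
  /-- Initial axiom: `X ⊢_h Y` for `δ : X ⟶ Y` with `p δ = h`. -/
  | ax {A B : C} {X Y : D} (eX : p.obj X = A) (eY : p.obj Y = B) (δ : X ⟶ Y) {h : A ⟶ B}
      (e : p.IsHomLift h δ) : Deriv p (.atom X eX) (.atom Y eY) h
  /-- Left push rule: from `S ⊢_{fg} T` infer `f₊ S ⊢_g T`. -/
  | pushL {A B E : C} {S : Frm p A} {T : Frm p E} (f : A ⟶ B) (g : B ⟶ E) {h : A ⟶ E}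
      (e : f ≫ g = h) (α : Deriv p S T h) : Deriv p (.push f S) T g
  /-- Right push rule: from `S ⊢_g T` infer `S ⊢_{gf} f₊ T`. -/
  | pushR {A B E : C} {S : Frm p A} {T : Frm p B} (f : B ⟶ E) {g : A ⟶ B} {h : A ⟶ E}
      (e : g ≫ f = h) (α : Deriv p S T g) : Deriv p S (.push f T) h
  /-- Left pull rule: from `S ⊢_g T` infer `f⁻ S ⊢_{fg} T`. -/
  | pullL {A B E : C} {S : Frm p B} {T : Frm p E} (f : A ⟶ B) {g : B ⟶ E} {h : A ⟶ E}
      (e : f ≫ g = h) (α : Deriv p S T g) : Deriv p (.pull f S) T h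
  /-- Right pull rule: from `S ⊢_{gf} T` infer `S ⊢_g f⁻ T`. -/
  | pullR {A B E : C} {S : Frm p A} {T : Frm p E} (f : B ⟶ E) (g : A ⟶ B) {h : A ⟶ E}
      (e : g ≫ f = h) (α : Deriv p S T h) : Deriv p S (.pull f T) g

variable {p : D ⥤ C}

/-- Permutation equivalence: the smallest congruence on proofs of a common sequent that
contains the four permutations of a left rule with a right rule. In each of the four generators,
the hypotheses `e₁, …, e₄` say that both sides are valid. -/
inductive PermEq : {A B : C} → {S : Frm p A} → {T : Frm p B} → {f : A ⟶ B} →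
    Deriv p S T f → Deriv p S T f → Prop
  | refl {A B : C} {S : Frm p A} {T : Frm p B} {f : A ⟶ B} (α : Deriv p S T f) : PermEq α α
  | symm {A B : C} {S : Frm p A} {T : Frm p B} {f : A ⟶ B} {α β : Deriv p S T f} :
      PermEq α β → PermEq β α
  | trans {A B : C} {S : Frm p A} {T : Frm p B} {f : A ⟶ B} {α β γ : Deriv p S T f} :
      PermEq α β → PermEq β γ → PermEq α γ
  | congr_pushL {A B E : C} {S : Frm p A} {T : Frm p E} (f : A ⟶ B) (g : B ⟶ E) {h : A ⟶ E}
      (e : f ≫ g = h) {α β : Deriv p S T h} :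
      PermEq α β → PermEq (.pushL f g e α) (.pushL f g e β)
  | congr_pushR {A B E : C} {S : Frm p A} {T : Frm p B} (f : B ⟶ E) {g : A ⟶ B} {h : A ⟶ E}
      (e : g ≫ f = h) {α β : Deriv p S T g} :
      PermEq α β → PermEq (.pushR f e α) (.pushR f e β)
  | congr_pullL {A B E : C} {S : Frm p B} {T : Frm p E} (f : A ⟶ B) {g : B ⟶ E} {h : A ⟶ E}
      (e : f ≫ g = h) {α β : Deriv p S T g} :
      PermEq α β → PermEq (.pullL f e α) (.pullL f e β)
  | congr_pullR {A B E : C} {S : Frm p A} {T : Frm p E} (f : B ⟶ E) (g : A ⟶ B) {h : A ⟶ E}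
      (e : g ≫ f = h) {α β : Deriv p S T h} :
      PermEq α β → PermEq (.pullR f g e α) (.pullR f g e β)
  /-- For `α` over `g`, with `fg`, `gh` and `fgh` written `x`, `y` and `k`. -/
  | pullL_pushR {A B E F : C} {S : Frm p B} {T : Frm p E} {f : A ⟶ B} {g : B ⟶ E} {h : E ⟶ F}
      {x : A ⟶ E} {y : B ⟶ F} {k : A ⟶ F} (e₁ : f ≫ g = x) (e₂ : x ≫ h = k)
      (e₃ : g ≫ h = y) (e₄ : f ≫ y = k) (α : Deriv p S T g) :
      PermEq (.pushR h e₂ (.pullL f e₁ α)) (.pullL f e₄ (.pushR h e₃ α))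
  /-- For `α` over `fg`, with `fg`, `gh` and `fgh` written `x`, `y` and `k`. -/
  | pushL_pushR {A B E F : C} {S : Frm p A} {T : Frm p E} {f : A ⟶ B} {g : B ⟶ E} {h : E ⟶ F}
      {x : A ⟶ E} {y : B ⟶ F} {k : A ⟶ F} (e₁ : f ≫ g = x) (e₂ : g ≫ h = y)
      (e₃ : x ≫ h = k) (e₄ : f ≫ y = k) (α : Deriv p S T x) :
      PermEq (.pushR h e₂ (.pushL f g e₁ α)) (.pushL f y e₄ (.pushR h e₃ α))
  /-- For `α` over `gh`, with `fg`, `gh` and `fgh` written `x`, `y` and `k`. -/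
  | pullL_pullR {A B E F : C} {S : Frm p B} {T : Frm p F} {f : A ⟶ B} {g : B ⟶ E} {h : E ⟶ F}
      {x : A ⟶ E} {y : B ⟶ F} {k : A ⟶ F} (e₁ : f ≫ y = k) (e₂ : x ≫ h = k)
      (e₃ : g ≫ h = y) (e₄ : f ≫ g = x) (α : Deriv p S T y) :
      PermEq (.pullR h x e₂ (.pullL f e₁ α)) (.pullL f e₄ (.pullR h g e₃ α))
  /-- For `α` over `fgh`, with `fg`, `gh` and `fgh` written `x`, `y` and `k`. -/
  | pushL_pullR {A B E F : C} {S : Frm p A} {T : Frm p F} {f : A ⟶ B} {g : B ⟶ E} {h : E ⟶ F}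
      {x : A ⟶ E} {y : B ⟶ F} {k : A ⟶ F} (e₁ : f ≫ y = k) (e₂ : g ≫ h = y)
      (e₃ : x ≫ h = k) (e₄ : f ≫ g = x) (α : Deriv p S T k) :
      PermEq (.pullR h g e₂ (.pushL f y e₁ α)) (.pushL f g e₄ (.pullR h x e₃ α))

end Calculus

/-! # Two finiteness conditions on a category -/

/-- All homsets are finite. -/
def LocallyFinite (C : Type u₂) [Category.{v₂} C] : Prop :=
  ∀ A B : C, Finite (A ⟶ B)

/-- If `fg = fh` and `gk = hk` then `g = h`. -/
def FactorizationPreordered (C : Type u₂) [Category.{v₂} C] : Prop :=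
  ∀ ⦃A B E F : C⦄ (f : A ⟶ B) (g h : B ⟶ E) (k : E ⟶ F),
    f ≫ g = f ≫ h → g ≫ k = h ≫ k → g = h

/-! # Effective presentations -/

/-- The code of an arrow: codes of its domain, of its codomain, and of the arrow itself. -/
abbrev ArrowCode : Type := ℕ × ℕ × ℕ

/-- A coding of the objects and arrows of a category by natural numbers. Distinct objects, and
distinct parallel arrows, have distinct codes, so equality can be read off the codes.
The set of codes need not be decidable. -/
structure Coding (C : Type u₂) [Category.{v₂} C] where
  /-- The code of an object. -/
  obj : C → ℕ
  obj_injective : Function.Injective obj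
  /-- The code of an arrow with known domain and codomain. -/
  hom : {A B : C} → (A ⟶ B) → ℕ
  hom_injective : ∀ A B : C, Function.Injective (fun f : A ⟶ B => hom f)

namespace Coding

variable {C : Type u₂} [Category.{v₂} C]

/-- The code of an arrow together with those of its domain and codomain. -/
def arrow (κ : Coding C) {A B : C} (f : A ⟶ B) : ArrowCode :=
  (κ.obj A, κ.obj B, κ.hom f)

/-- Composition is computable: some partial recursive function sends the codes of any two
composable arrows to the code of their composite. -/
def ComputableComp (κ : Coding C) : Prop :=
  ∃ c : ArrowCode × ArrowCode →. ℕ, Partrec c ∧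
    ∀ ⦃A B E : C⦄ (f : A ⟶ B) (g : B ⟶ E),
      c (κ.arrow f, κ.arrow g) = Part.some (κ.hom (f ≫ g))

/-- Homsets can be listed: some partial recursive function sends the codes of any two objects
`A`, `B` to a list of the codes of all arrows `A ⟶ B`. -/
def ComputableHomsets (κ : Coding C) : Prop :=
  ∃ e : ℕ × ℕ →. List ℕ, Partrec e ∧
    ∀ A B : C, ∃ l : List ℕ, e (κ.obj A, κ.obj B) = Part.some l ∧
      ∀ n : ℕ, n ∈ l ↔ ∃ f : A ⟶ B, κ.hom f = n

/-- Diagonal fillers are computable: some partial recursive function, applied to the codes of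
any commuting square `x ≫ k = f ≫ y`, outputs either the code of some diagonal `l` with
`f ≫ l = x` and `l ≫ k = y`, or, if there is no such `l`, the value `none`. -/
def ComputableFillers (κ : Coding C) : Prop :=
  ∃ d : ArrowCode × ArrowCode × ArrowCode × ArrowCode →. Option ℕ, Partrec d ∧
    ∀ ⦃A B E F : C⦄ (f : A ⟶ B) (x : A ⟶ E) (y : B ⟶ F) (k : E ⟶ F), x ≫ k = f ≫ y →
      (∃ l : B ⟶ E, f ≫ l = x ∧ l ≫ k = y ∧
        d (κ.arrow f, κ.arrow x, κ.arrow y, κ.arrow k) = Part.some (some (κ.hom l))) ∨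
      ((¬ ∃ l : B ⟶ E, f ≫ l = x ∧ l ≫ k = y) ∧
        d (κ.arrow f, κ.arrow x, κ.arrow y, κ.arrow k) = Part.some none)

end Coding

/-- The code of a rule instance: the name of the rule, the arrow of the connective that it
introduces, the base of its premise, and the base of its conclusion. -/
abbrev RuleCode : Type := ℕ × ArrowCode × ArrowCode × ArrowCode

/-- The code of a proof: the arrow `δ` of its axiom and the base `p δ` of that axiom, then the
list of its rule instances, from the conclusion upwards. -/
abbrev ProofCode : Type := (ArrowCode × ArrowCode) × List RuleCode

section ProofCodes

variable {D : Type u₁} [Category.{v₁} D] {C : Type u₂} [Category.{v₂} C] {p : D ⥤ C}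

/-- The code of a proof, relative to codings of the two categories: the proof as a list of rules
in which every sequent is labelled with its base arrow. -/
def Deriv.code (κD : Coding D) (κC : Coding C) : {A B : C} → {S : Frm p A} → {T : Frm p B} →
    {f : A ⟶ B} → Deriv p S T f → ProofCode
  | _, _, _, _, h, .ax _ _ δ _ => ((κD.arrow δ, κC.arrow h), [])
  | _, _, _, _, _, .pushL (h := h) f g _ α =>
      ((α.code κD κC).1, (0, κC.arrow f, κC.arrow h, κC.arrow g) :: (α.code κD κC).2)
  | _, _, _, _, _, .pushR (g := g) (h := h) f _ α =>
      ((α.code κD κC).1, (1, κC.arrow f, κC.arrow g, κC.arrow h) :: (α.code κD κC).2)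
  | _, _, _, _, _, .pullL (g := g) (h := h) f _ α =>
      ((α.code κD κC).1, (2, κC.arrow f, κC.arrow g, κC.arrow h) :: (α.code κD κC).2)
  | _, _, _, _, _, .pullR (h := h) f g _ α =>
      ((α.code κD κC).1, (3, κC.arrow f, κC.arrow h, κC.arrow g) :: (α.code κD κC).2)

end ProofCodes

end Bifibrational

/-!
A proof is an interleaving of left rules, dictated by the formula on the left, with right rules,
dictated by the formula on the right, in which every sequent is labelled with a base arrow. In
these terms all four generators of permutation equivalence say the same thing (`PermEq.swap`): a
left rule and a right rule next to each other may be swapped, whenever there is a base arrow for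
the sequent between them that makes the swapped rules valid. A proof of a given sequent is
determined by its code (`Deriv.code_injective`), so the question is about a rewriting relation
`Step` on lists of rule codes, whose finitely many successors of a list can be computed once the
possible new middle base arrows can be.

It suffices (`SwapSpec.exists_decision`) to find a computable set of swaps, each of them a
permutation of proofs, such that every list has finitely many reducts and equivalent proofs have
a common reduct: all reducts of both proofs are then computed, by saturation, and compared.

* If homsets are finite and can be listed, all swaps, in both directions, are taken. Swaps create
  no objects, and hence involve only finitely many arrows
  (`finite_reflTransGen_step_homCandidates`). The relation is symmetric on the codes of proofs, so
  equivalent proofs rewrite to each other.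
* If the category is factorization preordered and fillers can be computed, only the swaps of a
  right rule below a left rule are taken. The new middle arrow is the diagonal filler of a square
  when both are pull rules, and a composite of known arrows otherwise; in all cases it is unique.
  Each swap moves a right rule away from the conclusion, so rewriting terminates. The redexes of a
  list are disjoint, since in each of them a right rule comes first and a left rule second; with
  uniqueness this gives the diamond property (`step_diamond`), and the Church-Rosser theorem
  yields common reducts.
-/

namespace Bifibrational

/-! ### Saturation of a computable successor function -/

section Saturation

variable {α β : Type*}

/-- The concatenation of the lists `f a`, for `a` in `l`, where `f` is a partial function. -/
def partFlatMap (f : α →. List β) (l : List α) : Part (List β) :=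
  l.foldl (fun r a => r.bind fun acc => (f a).map (acc ++ ·)) (Part.some [])

theorem partFlatMap_append_singleton (f : α →. List β) (l : List α) (a : α) :
    partFlatMap f (l ++ [a]) = (partFlatMap f l).bind fun acc => (f a).map (acc ++ ·) := by
  simp [partFlatMap]

theorem exists_mem_partFlatMap {f : α →. List β} {l : List α} (h : ∀ a ∈ l, (f a).Dom) :
    ∃ L, L ∈ partFlatMap f l := by
  induction l using List.reverseRecOn with
  | nil => exact ⟨[], Part.mem_some _⟩
  | append_singleton l a ih =>
    obtain ⟨L, hL⟩ := ih fun b hb => h b (by simp [hb])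
    obtain ⟨M, hM⟩ := Part.dom_iff_mem.1 (h a (by simp))
    rw [partFlatMap_append_singleton]
    exact ⟨L ++ M, Part.mem_bind hL (Part.mem_map _ hM)⟩

theorem mem_of_mem_partFlatMap {f : α →. List β} {l : List α} {L : List β}
    (hL : L ∈ partFlatMap f l) (b : β) : b ∈ L ↔ ∃ a ∈ l, ∃ M ∈ f a, b ∈ M := by
  induction l using List.reverseRecOn generalizing L with
  | nil =>
    obtain rfl : L = [] := by simpa [partFlatMap] using hL
    simp
  | append_singleton l a ih =>
    rw [partFlatMap_append_singleton, Part.mem_bind_iff] at hL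
    obtain ⟨L', hL', hL⟩ := hL
    obtain ⟨M, hM, rfl⟩ := (Part.mem_map_iff _).1 hL
    rw [List.mem_append, ih hL']
    constructor
    · rintro (⟨c, hc, N, hN, hb⟩ | hb)
      · exact ⟨c, by simp [hc], N, hN, hb⟩
      · exact ⟨a, by simp, M, hM, hb⟩
    · rintro ⟨c, hc, N, hN, hb⟩
      rcases List.mem_append.1 hc with hc | hc
      · exact .inl ⟨c, hc, N, hN, hb⟩
      · obtain rfl : c = a := by simpa using hc
        exact .inr (Part.mem_unique hN hM ▸ hb)

variable [Primcodable α] [Primcodable β]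

theorem partrec_partFlatMap {f : α →. List β} (hf : Partrec f) : Partrec (partFlatMap f) := by
  have key : Partrec fun l : List α => (Nat.rec (Part.some [])
      (fun i r => r.bind fun acc =>
        Option.casesOn l[i]? (Part.some acc) fun a => (f a).map (acc ++ ·)) l.length :
        Part (List β)) := by
    refine Partrec.nat_rec (h := fun (l : List α) (w : ℕ × List β) =>
      (Option.casesOn l[w.1]? (Part.some w.2) fun a => (f a).map (w.2 ++ ·) : Part (List β)))
      Computable.list_length (Computable.const []).partrec ?_
    refine Partrec.optionCasesOn_right (Computable.list_getElem?.comp Computable.fst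
      (Computable.fst.comp Computable.snd)) (Computable.snd.comp Computable.snd) ?_
    refine Partrec.map (hf.comp Computable.snd) ?_
    exact Computable.list_append.comp
      (Computable.snd.comp (Computable.snd.comp (Computable.fst.comp Computable.fst)))
      Computable.snd
  refine key.of_eq fun l => ?_
  suffices ∀ k, (Nat.rec (Part.some [])
      (fun i r => r.bind fun acc =>
        Option.casesOn l[i]? (Part.some acc) fun a => (f a).map (acc ++ ·)) k :
        Part (List β)) = partFlatMap f (l.take k) by
    simpa using this l.length
  intro k
  induction k with
  | zero => rfl
  | succ k ih =>
    simp only [ih, List.take_add_one]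
    cases l[k]? with
    | none => simp [Part.bind_some_right]
    | some a => simp [partFlatMap_append_singleton]

/-- The elements of `l` that satisfy the partial test `f`. -/
def partFilter (f : α →. Bool) (l : List α) : Part (List α) :=
  partFlatMap (fun a => (f a).map fun b => cond b [a] []) l

theorem partrec_partFilter {f : α →. Bool} (hf : Partrec f) : Partrec (partFilter f) :=
  partrec_partFlatMap (Partrec.map hf (Computable.cond Computable.snd
    (Computable.list_cons.comp Computable.fst (Computable.const [])) (Computable.const [])))

omit [Primcodable α] in
theorem exists_mem_partFilter {f : α →. Bool} {l : List α} (h : ∀ a ∈ l, (f a).Dom) :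
    ∃ L, L ∈ partFilter f l :=
  exists_mem_partFlatMap h

omit [Primcodable α] in
theorem mem_of_mem_partFilter {f : α →. Bool} {l L : List α} (hL : L ∈ partFilter f l) (a : α) :
    a ∈ L ↔ a ∈ l ∧ true ∈ f a := by
  rw [mem_of_mem_partFlatMap hL]
  constructor
  · rintro ⟨b, hb, M, hM, ha⟩
    obtain ⟨t, ht, rfl⟩ := (Part.mem_map_iff _).1 hM
    cases t <;> simp at ha
    exact ha ▸ ⟨hb, ht⟩
  · rintro ⟨ha, ht⟩
    exact ⟨a, ha, _, Part.mem_map _ ht, by simp⟩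

/-- The one-step relation of a partial function that lists successors. -/
def Succ (f : α →. List α) (x y : α) : Prop := ∃ L ∈ f x, y ∈ L

/-- The elements reached from `x` in at most `n` steps, as a list. -/
def reachN (f : α →. List α) (x : α) (n : ℕ) : Part (List α) :=
  Nat.rec (Part.some [x]) (fun _ r => r.bind fun R => (partFlatMap f R).map (R ++ ·)) n

/-- Whether every successor of an element reached in at most `n` steps is also so reached. -/
def isClosedAt [DecidableEq α] (f : α →. List α) (x : α) (n : ℕ) : Part Bool :=
  (reachN f x n).bind fun R => (partFlatMap f R).map fun L => decide (∀ y ∈ L, y ∈ R)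

/-- The elements reached from `x`, as a list: steps are added until the list is closed. -/
def saturate [DecidableEq α] (f : α →. List α) (x : α) : Part (List α) :=
  (Nat.rfind fun n => isClosedAt f x n).bind (reachN f x)

theorem partrec_reachN {f : α →. List α} (hf : Partrec f) : Partrec₂ (reachN f) := by
  refine Partrec.nat_rec (f := fun w : α × ℕ => w.2) (g := fun w : α × ℕ => Part.some [w.1])
    (h := fun _ w => (partFlatMap f w.2).map (w.2 ++ ·)) Computable.snd
    (Computable.list_cons.comp Computable.fst (Computable.const [])).partrec ?_
  refine Partrec.map ((partrec_partFlatMap hf).comp (Computable.snd.comp Computable.snd)) ?_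
  exact Computable.list_append.comp
    (Computable.snd.comp (Computable.snd.comp Computable.fst)) Computable.snd

theorem primrec_mem [DecidableEq α] : PrimrecRel fun (y : α) (R : List α) => y ∈ R :=
  (PrimrecRel.exists_mem_list (R := fun a b : α => a = b) Primrec.eq).swap.of_eq (by simp)

theorem partrec_saturate [DecidableEq α] {f : α →. List α} (hf : Partrec f) :
    Partrec (saturate f) := by
  refine Partrec.bind (Partrec.rfind ?_) (partrec_reachN hf)
  refine Partrec.bind (partrec_reachN hf) ?_
  refine Partrec.map ((partrec_partFlatMap hf).comp Computable.snd) ?_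
  exact primrec_mem.forall_mem_list.decide.to_comp.comp Computable.snd
    (Computable.snd.comp Computable.fst)

omit [Primcodable α] in
open Relation in
/-- If `f` is defined on a set `Q` that it maps to itself, and only finitely many elements can be
reached from `x ∈ Q`, then the saturation terminates, with the list of these elements. -/
theorem exists_mem_saturate [DecidableEq α] {f : α →. List α} {Q : α → Prop}
    (hdom : ∀ y, Q y → (f y).Dom) (hQ : ∀ y z, Q y → Succ f y z → Q z) {x : α} (hx : Q x)
    (hfin : {y | ReflTransGen (Succ f) x y}.Finite) :
    ∃ R ∈ saturate f x, ∀ y, y ∈ R ↔ ReflTransGen (Succ f) x y := by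
  have hreachQ : ∀ y, ReflTransGen (Succ f) x y → Q y := fun y h => by
    induction h with
    | refl => exact hx
    | tail _ h ih => exact hQ _ _ ih h
  have hflat : ∀ R : List α, (∀ y ∈ R, ReflTransGen (Succ f) x y) →
      ∃ L ∈ partFlatMap f R, ∀ y, y ∈ L ↔ ∃ z ∈ R, Succ f z y := fun R hR => by
    obtain ⟨L, hL⟩ := exists_mem_partFlatMap fun y hy => hdom y (hreachQ y (hR y hy))
    exact ⟨L, hL, mem_of_mem_partFlatMap hL⟩
  have hreach : ∀ n, ∃ R ∈ reachN f x n, (∀ y ∈ R, ReflTransGen (Succ f) x y) ∧ x ∈ R := by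
    intro n
    induction n with
    | zero => exact ⟨[x], Part.mem_some _, by simp [ReflTransGen.refl], by simp⟩
    | succ n ih =>
      obtain ⟨R, hR, hs, hxR⟩ := ih
      obtain ⟨L, hL, hLs⟩ := hflat R hs
      refine ⟨R ++ L, Part.mem_bind hR (Part.mem_map _ hL), fun y hy => ?_, by simp [hxR]⟩
      rcases List.mem_append.1 hy with hy | hy
      · exact hs y hy
      · obtain ⟨z, hz, hzy⟩ := (hLs y).1 hy
        exact (hs z hz).tail hzy
  choose R hR hRs hxR using hreach
  have hsucc : ∀ n y z, y ∈ R n → Succ f y z → z ∈ R (n + 1) := fun n y z hy hyz => by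
    obtain ⟨L, hL, hLs⟩ := hflat (R n) (hRs n)
    have : R n ++ L ∈ reachN f x (n + 1) := Part.mem_bind (hR n) (Part.mem_map _ hL)
    rw [Part.mem_unique (hR (n + 1)) this]
    exact List.mem_append.2 (.inr ((hLs z).2 ⟨y, hy, hyz⟩))
  have hmono : Monotone fun n => {y | y ∈ R n} := monotone_nat_of_le_succ fun n y hy => by
    obtain ⟨L, hL, hLs⟩ := hflat (R n) (hRs n)
    have : R n ++ L ∈ reachN f x (n + 1) := Part.mem_bind (hR n) (Part.mem_map _ hL)
    change y ∈ R (n + 1)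
    rw [Part.mem_unique (hR (n + 1)) this]
    exact List.mem_append.2 (.inl hy)
  have hall : ∀ y, ReflTransGen (Succ f) x y → ∃ n, y ∈ R n := fun y h => by
    induction h with
    | refl => exact ⟨0, hxR 0⟩
    | tail _ h ih =>
      obtain ⟨n, hn⟩ := ih
      exact ⟨n + 1, hsucc n _ _ hn h⟩
  have hstab : ∃ n, ∀ y, ReflTransGen (Succ f) x y → y ∈ R n := by
    choose! N hN using hall
    obtain ⟨n, hn⟩ := (hfin.image N).bddAbove
    exact ⟨n, fun y hy => hmono (hn ⟨y, hy, rfl⟩) (hN y hy)⟩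
  have hchk : ∀ n, ∃ b ∈ isClosedAt f x n,
      b = true ↔ ∀ y z, y ∈ R n → Succ f y z → z ∈ R n := fun n => by
    obtain ⟨L, hL, hLs⟩ := hflat (R n) (hRs n)
    refine ⟨_, Part.mem_bind (hR n) (Part.mem_map _ hL), ?_⟩
    simp only [decide_eq_true_eq, hLs]
    exact ⟨fun h y z hy hyz => h z ⟨y, hy, hyz⟩, fun h z ⟨y, hy, hyz⟩ => h y z hy hyz⟩
  obtain ⟨n, hn⟩ := hstab
  have hterm : (Nat.rfind fun n => isClosedAt f x n).Dom := by
    refine Nat.rfind_dom'.2 ⟨n, ?_, fun {m} _ => ?_⟩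
    · obtain ⟨b, hb, hbt⟩ := hchk n
      rwa [hbt.2 fun y z hy hyz => hn z ((hRs n y hy).tail hyz)] at hb
    · obtain ⟨b, hb, _⟩ := hchk m
      exact Part.dom_iff_mem.2 ⟨b, hb⟩
  obtain ⟨m, hm⟩ := Part.dom_iff_mem.1 hterm
  refine ⟨R m, Part.mem_bind hm (hR m), fun y => ⟨hRs m y, fun hy => ?_⟩⟩
  obtain ⟨b, hb, hbt⟩ := hchk m
  have hclosed := hbt.1 (Part.mem_unique hb (Nat.rfind_spec hm))
  induction hy with
  | refl => exact hxR m
  | tail _ h ih => exact hclosed _ _ ih h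

end Saturation

/-! ### Rewriting adjacent entries of a list -/

section ListRewriting

variable {ρ : Type*}

/-- Rewriting of lists by the replacement of two adjacent entries, as listed by `sw`. -/
inductive Step (sw : ρ × ρ →. List (ρ × ρ)) : List ρ → List ρ → Prop
  | swap {r s a b : ρ} {L : List (ρ × ρ)} (l : List ρ) (hL : L ∈ sw (r, s)) (h : (a, b) ∈ L) :
      Step sw (r :: s :: l) (a :: b :: l)
  | cons {l m : List ρ} (r : ρ) (h : Step sw l m) : Step sw (r :: l) (r :: m)

/-- The two entries at positions `i` and `i + 1`, with what precedes and what follows them. -/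
def splitAtPair (l : List ρ) (i : ℕ) : Option (List ρ × (ρ × ρ) × List ρ) :=
  l[i]?.bind fun r => l[i + 1]?.map fun s => (l.take i, (r, s), l.drop (i + 2))

/-- All pairs of adjacent entries of a list, with their contexts. -/
def adjacentPairs (l : List ρ) : List (List ρ × (ρ × ρ) × List ρ) :=
  (List.range l.length).filterMap (splitAtPair l)

theorem mem_adjacentPairs {l p q : List ρ} {r s : ρ} :
    (p, (r, s), q) ∈ adjacentPairs l ↔ l = p ++ r :: s :: q := by
  simp only [adjacentPairs, List.mem_filterMap, List.mem_range, splitAtPair,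
    Option.bind_eq_some_iff, Option.map_eq_some_iff, Prod.mk.injEq]
  constructor
  · rintro ⟨i, -, r', hr, s', hs, rfl, ⟨rfl, rfl⟩, rfl⟩
    obtain ⟨hi, rfl⟩ := List.getElem?_eq_some_iff.1 hr
    obtain ⟨hi', rfl⟩ := List.getElem?_eq_some_iff.1 hs
    rw [List.getElem_cons_drop hi', List.getElem_cons_drop hi, List.take_append_drop]
  · rintro rfl
    refine ⟨p.length, by simp, r, by simp, s, ?_, by simp, by simp, ?_⟩ <;> simp

/-- The lists to which a list rewrites in one step. -/
def stepList (sw : ρ × ρ →. List (ρ × ρ)) (l : List ρ) : Part (List (List ρ)) :=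
  partFlatMap (fun w : List ρ × (ρ × ρ) × List ρ =>
    (sw w.2.1).map fun L => L.map fun ab => w.1 ++ ab.1 :: ab.2 :: w.2.2) (adjacentPairs l)

theorem step_iff {sw : ρ × ρ →. List (ρ × ρ)} {l m : List ρ} :
    Step sw l m ↔ ∃ p q r s a b L, l = p ++ r :: s :: q ∧ L ∈ sw (r, s) ∧ (a, b) ∈ L ∧
      m = p ++ a :: b :: q := by
  constructor
  · intro h
    induction h with
    | swap l hL h => exact ⟨[], l, _, _, _, _, _, rfl, hL, h, rfl⟩
    | cons t _ ih =>
      obtain ⟨p, q, r, s, a, b, L, rfl, hL, h, rfl⟩ := ih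
      exact ⟨t :: p, q, r, s, a, b, L, rfl, hL, h, rfl⟩
  · rintro ⟨p, q, r, s, a, b, L, rfl, hL, h, rfl⟩
    induction p with
    | nil => exact .swap q hL h
    | cons t p ih => exact .cons t ih

theorem step_of_succ {sw : ρ × ρ →. List (ρ × ρ)} {l m : List ρ}
    (h : Succ (stepList sw) l m) : Step sw l m := by
  obtain ⟨R, hR, hm⟩ := h
  obtain ⟨⟨p, ⟨r, s⟩, q⟩, hw, M, hM, hm⟩ := (mem_of_mem_partFlatMap hR m).1 hm
  obtain ⟨L, hL, rfl⟩ := (Part.mem_map_iff _).1 hM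
  obtain ⟨⟨a, b⟩, hab, rfl⟩ := List.mem_map.1 hm
  exact step_iff.2 ⟨p, q, r, s, a, b, L, mem_adjacentPairs.1 hw, hL, hab, rfl⟩

theorem succ_of_step {sw : ρ × ρ →. List (ρ × ρ)} {l m : List ρ}
    (hdom : (stepList sw l).Dom) (h : Step sw l m) : Succ (stepList sw) l m := by
  obtain ⟨R, hR⟩ := Part.dom_iff_mem.1 hdom
  obtain ⟨p, q, r, s, a, b, L, hl, hL, hab, rfl⟩ := step_iff.1 h
  exact ⟨R, hR, (mem_of_mem_partFlatMap hR _).2 ⟨(p, (r, s), q), mem_adjacentPairs.2 hl, _,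
    Part.mem_map _ hL, List.mem_map.2 ⟨(a, b), hab, rfl⟩⟩⟩

theorem stepList_dom {sw : ρ × ρ →. List (ρ × ρ)} {l : List ρ}
    (h : ∀ p r s q, l = p ++ r :: s :: q → (sw (r, s)).Dom) : (stepList sw l).Dom :=
  Part.dom_iff_mem.2 <| exists_mem_partFlatMap fun ⟨p, (r, s), q⟩ hw =>
    h p r s q (mem_adjacentPairs.1 hw)

theorem partrec_stepList [Primcodable ρ] {sw : ρ × ρ →. List (ρ × ρ)} (hsw : Partrec sw) :
    Partrec (stepList sw) := by
  have hsplit : Primrec₂ (splitAtPair (ρ := ρ)) := by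
    refine Primrec.option_bind (Primrec.list_getElem?.comp Primrec.fst Primrec.snd) ?_
    refine Primrec.option_map (Primrec.list_getElem?.comp (Primrec.fst.comp Primrec.fst)
      (Primrec.succ.comp (Primrec.snd.comp Primrec.fst))) ?_
    have hl : Primrec fun w : ((List ρ × ℕ) × ρ) × ρ => w.1.1.1 :=
      Primrec.fst.comp (Primrec.fst.comp Primrec.fst)
    have hi : Primrec fun w : ((List ρ × ℕ) × ρ) × ρ => w.1.1.2 :=
      Primrec.snd.comp (Primrec.fst.comp Primrec.fst)
    exact (Primrec.list_take.comp hi hl).pair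
      (((Primrec.snd.comp Primrec.fst).pair Primrec.snd).pair
        (Primrec.list_drop.comp (Primrec.succ.comp (Primrec.succ.comp hi)) hl))
  have hadj : Primrec (adjacentPairs (ρ := ρ)) :=
    Primrec.listFilterMap (Primrec.list_range.comp Primrec.list_length) hsplit
  refine (partrec_partFlatMap (Partrec.map (hsw.comp (Computable.fst.comp Computable.snd))
    (Primrec.to_comp ?_))).comp hadj.to_comp
  refine Primrec.list_map Primrec.snd ?_
  refine Primrec.list_append.comp (Primrec.fst.comp (Primrec.fst.comp Primrec.fst))
    (Primrec.list_cons.comp (Primrec.fst.comp Primrec.snd)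
      (Primrec.list_cons.comp (Primrec.snd.comp Primrec.snd)
        (Primrec.snd.comp (Primrec.snd.comp (Primrec.fst.comp Primrec.fst)))))

end ListRewriting

/-! ### Left rules and right rules -/

section Sides

variable {D : Type u₁} [Category.{v₁} D] {C : Type u₂} [Category.{v₂} C] {p : D ⥤ C}

variable (C) in
/-- The instances of the two left rules, without their sequents: `LeftRule C A B` turns formulas
over `A` into formulas over `B`, on the left of a sequent. -/
inductive LeftRule : C → C → Type (max u₂ v₂)
  | push {A B : C} (f : A ⟶ B) : LeftRule A B
  | pull {A B : C} (f : B ⟶ A) : LeftRule A B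

variable (C) in
/-- The instances of the two right rules, without their sequents: `RightRule C A B` turns formulas
over `A` into formulas over `B`, on the right of a sequent. -/
inductive RightRule : C → C → Type (max u₂ v₂)
  | push {A B : C} (f : A ⟶ B) : RightRule A B
  | pull {A B : C} (f : B ⟶ A) : RightRule A B

namespace LeftRule

/-- The formula that a left rule introduces. -/
def apply {A B : C} (ρ : LeftRule C A B) (S : Frm p A) : Frm p B :=
  match ρ with
  | push f => .push f S
  | pull f => .pull f S

/-- A left rule is valid with premise over `g` and conclusion over `g'`. -/
def Valid {A B E : C} (ρ : LeftRule C A B) (g : A ⟶ E) (g' : B ⟶ E) : Prop :=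
  match ρ with
  | push f => f ≫ g' = g
  | pull f => f ≫ g = g'

/-- The code of the instance of a left rule with premise over `g` and conclusion over `g'`. -/
def code (κ : Coding C) {A B E : C} (ρ : LeftRule C A B) (g : A ⟶ E) (g' : B ⟶ E) : RuleCode :=
  match ρ with
  | push f => (0, κ.arrow f, κ.arrow g, κ.arrow g')
  | pull f => (2, κ.arrow f, κ.arrow g, κ.arrow g')

end LeftRule

namespace RightRule

/-- The formula that a right rule introduces. -/
def apply {A B : C} (σ : RightRule C A B) (T : Frm p A) : Frm p B :=
  match σ with
  | push f => .push f T
  | pull f => .pull f T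

/-- A right rule is valid with premise over `g` and conclusion over `g'`. -/
def Valid {A B E : C} (σ : RightRule C A B) (g : E ⟶ A) (g' : E ⟶ B) : Prop :=
  match σ with
  | push f => g ≫ f = g'
  | pull f => g' ≫ f = g

/-- The code of the instance of a right rule with premise over `g` and conclusion over `g'`. -/
def code (κ : Coding C) {A B E : C} (σ : RightRule C A B) (g : E ⟶ A) (g' : E ⟶ B) : RuleCode :=
  match σ with
  | push f => (1, κ.arrow f, κ.arrow g, κ.arrow g')
  | pull f => (3, κ.arrow f, κ.arrow g, κ.arrow g')

end RightRule

namespace Deriv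

/-- The proof that ends with a given left rule. -/
def left {A A' B : C} {S : Frm p A} {T : Frm p B} {g : A ⟶ B} {g' : A' ⟶ B}
    (ρ : LeftRule C A A') (v : ρ.Valid g g') (α : Deriv p S T g) : Deriv p (ρ.apply S) T g' :=
  match ρ, v with
  | .push f, v => .pushL f g' v α
  | .pull f, v => .pullL f v α

/-- The proof that ends with a given right rule. -/
def right {A B B' : C} {S : Frm p A} {T : Frm p B} {g : A ⟶ B} {g' : A ⟶ B'}
    (σ : RightRule C B B') (v : σ.Valid g g') (α : Deriv p S T g) : Deriv p S (σ.apply T) g' :=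
  match σ, v with
  | .push f, v => .pushR f v α
  | .pull f, v => .pullR f g' v α

/-- Induction on proofs by the side of the last rule, which halves the number of cases. -/
theorem induction_sides
    {motive : ∀ {A B : C} {S : Frm p A} {T : Frm p B} {h : A ⟶ B}, Deriv p S T h → Prop}
    (ax : ∀ {A B : C} {X Y : D} (eX : p.obj X = A) (eY : p.obj Y = B) (δ : X ⟶ Y) {h : A ⟶ B}
      (e : p.IsHomLift h δ), motive (.ax eX eY δ e))
    (left : ∀ {A A' B : C} {S : Frm p A} {T : Frm p B} {g : A ⟶ B} {g' : A' ⟶ B}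
      (ρ : LeftRule C A A') (v : ρ.Valid g g') (α : Deriv p S T g), motive α →
        motive (α.left ρ v))
    (right : ∀ {A B B' : C} {S : Frm p A} {T : Frm p B} {g : A ⟶ B} {g' : A ⟶ B'}
      (σ : RightRule C B B') (v : σ.Valid g g') (α : Deriv p S T g), motive α →
        motive (α.right σ v))
    {A B : C} {S : Frm p A} {T : Frm p B} {h : A ⟶ B} (α : Deriv p S T h) : motive α := by
  induction α with
  | ax eX eY δ e => exact ax eX eY δ e
  | pushL f g e α ih => exact left (.push f) e α ih
  | pushR f e α ih => exact right (.push f) e α ih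
  | pullL f e α ih => exact left (.pull f) e α ih
  | pullR f g e α ih => exact right (.pull f) e α ih

variable (κD : Coding D) (κC : Coding C)

theorem code_left {A A' B : C} {S : Frm p A} {T : Frm p B} {g : A ⟶ B} {g' : A' ⟶ B}
    (ρ : LeftRule C A A') (v : ρ.Valid g g') (α : Deriv p S T g) :
    (α.left ρ v).code κD κC =
      ((α.code κD κC).1, ρ.code κC g g' :: (α.code κD κC).2) := by
  cases ρ <;> rfl

theorem code_right {A B B' : C} {S : Frm p A} {T : Frm p B} {g : A ⟶ B} {g' : A ⟶ B'}
    (σ : RightRule C B B') (v : σ.Valid g g') (α : Deriv p S T g) :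
    (α.right σ v).code κD κC =
      ((α.code κD κC).1, σ.code κC g g' :: (α.code κD κC).2) := by
  cases σ <;> rfl

/-- A proof of a given sequent is determined by its code. -/
theorem code_injective {A B : C} {S : Frm p A} {T : Frm p B} {h : A ⟶ B}
    (α β : Deriv p S T h) (hc : α.code κD κC = β.code κD κC) : α = β := by
  induction α with
  | ax eX eY δ e =>
    cases β with
    | ax _ _ δ' _ =>
      simp only [code, Coding.arrow, Prod.mk.injEq] at hc
      obtain rfl := κD.hom_injective _ _ hc.1.1.2.2
      rfl
  | pushL f g e α ih =>
    cases β with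
    | pushL _ _ e' β =>
      subst e e'
      simp only [code, Prod.mk.injEq, List.cons.injEq] at hc
      rw [ih β (Prod.ext hc.1 hc.2.2)]
    | pushR => simp [code] at hc
    | pullR => simp [code] at hc
  | pullL f e α ih =>
    cases β with
    | @pullL _ _ _ _ _ _ g' _ e' β =>
      simp only [code, Coding.arrow, Prod.mk.injEq, List.cons.injEq] at hc
      obtain rfl := κC.hom_injective _ _ hc.2.1.2.2.1.2.2
      rw [ih β (Prod.ext hc.1 hc.2.2)]
    | pushR => simp [code] at hc
    | pullR => simp [code] at hc
  | pushR f e α ih =>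
    cases β with
    | @pushR _ _ _ _ _ _ g' _ e' β =>
      simp only [code, Coding.arrow, Prod.mk.injEq, List.cons.injEq] at hc
      obtain rfl := κC.hom_injective _ _ hc.2.1.2.2.1.2.2
      rw [ih β (Prod.ext hc.1 hc.2.2)]
    | pushL => simp [code] at hc
    | pullL => simp [code] at hc
  | pullR f g e α ih =>
    cases β with
    | pullR _ _ e' β =>
      subst e e'
      simp only [code, Prod.mk.injEq, List.cons.injEq] at hc
      rw [ih β (Prod.ext hc.1 hc.2.2)]
    | pushL => simp [code] at hc
    | pullL => simp [code] at hc

end Deriv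

namespace PermEq

theorem left {A A' B : C} {S : Frm p A} {T : Frm p B} {g : A ⟶ B} {g' : A' ⟶ B}
    (ρ : LeftRule C A A') (v : ρ.Valid g g') {α β : Deriv p S T g} (h : PermEq α β) :
    PermEq (α.left ρ v) (β.left ρ v) := by
  cases ρ with
  | push f => exact .congr_pushL f g' v h
  | pull f => exact .congr_pullL f v h

theorem right {A B B' : C} {S : Frm p A} {T : Frm p B} {g : A ⟶ B} {g' : A ⟶ B'}
    (σ : RightRule C B B') (v : σ.Valid g g') {α β : Deriv p S T g} (h : PermEq α β) :
    PermEq (α.right σ v) (β.right σ v) := by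
  cases σ with
  | push f => exact .congr_pushR f v h
  | pull f => exact .congr_pullR f g' v h

/-- The four generators at once: a left rule and a right rule permute whenever both orders are
valid. -/
theorem swap {A A' B B' : C} {S : Frm p A} {T : Frm p B} {t : A ⟶ B} {m : A' ⟶ B}
    {m' : A ⟶ B'} {c : A' ⟶ B'} (ρ : LeftRule C A A') (σ : RightRule C B B')
    (h₁ : ρ.Valid t m) (h₂ : σ.Valid m c) (h₃ : σ.Valid t m') (h₄ : ρ.Valid m' c)
    (α : Deriv p S T t) :
    PermEq ((α.left ρ h₁).right σ h₂) ((α.right σ h₃).left ρ h₄) := by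
  cases ρ <;> cases σ
  · exact .pushL_pushR h₁ h₂ h₃ h₄ α
  · exact .pushL_pullR h₁ h₂ h₃ h₄ α
  · exact .pullL_pushR h₁ h₂ h₃ h₄ α
  · exact .pullL_pullR h₁ h₂ h₃ h₄ α

/-- An equivalence relation on lists of rule codes relates the codes of equivalent proofs, if it is
compatible with adding a rule and relates both orders of a left rule and a right rule. -/
theorem rel_code {κD : Coding D} {κC : Coding C} {R : List RuleCode → List RuleCode → Prop}
    (hR : Equivalence R) (hcons : ∀ r l m, R l m → R (r :: l) (r :: m))
    (hswap : ∀ {A A' B B' : C} {t : A ⟶ B} {m : A' ⟶ B} {m' : A ⟶ B'} {c : A' ⟶ B'}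
      (ρ : LeftRule C A A') (σ : RightRule C B B'), ρ.Valid t m → σ.Valid m c →
      σ.Valid t m' → ρ.Valid m' c → ∀ l,
      R (σ.code κC m c :: ρ.code κC t m :: l) (ρ.code κC m' c :: σ.code κC t m' :: l))
    {A B : C} {S : Frm p A} {T : Frm p B} {f : A ⟶ B} {α β : Deriv p S T f}
    (h : PermEq α β) :
    (α.code κD κC).1 = (β.code κD κC).1 ∧ R (α.code κD κC).2 (β.code κD κC).2 := by
  induction h with
  | refl α => exact ⟨rfl, hR.refl _⟩
  | symm _ ih => exact ⟨ih.1.symm, hR.symm ih.2⟩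
  | trans _ _ ih ih' => exact ⟨ih.1.trans ih'.1, hR.trans ih.2 ih'.2⟩
  | congr_pushL f g e _ ih => exact ⟨ih.1, hcons _ _ _ ih.2⟩
  | congr_pushR f e _ ih => exact ⟨ih.1, hcons _ _ _ ih.2⟩
  | congr_pullL f e _ ih => exact ⟨ih.1, hcons _ _ _ ih.2⟩
  | congr_pullR f g e _ ih => exact ⟨ih.1, hcons _ _ _ ih.2⟩
  | @pullL_pushR _ _ _ _ _ _ f _ h _ _ _ e₁ e₂ e₃ e₄ α =>
    exact ⟨rfl, hswap (.pull f) (.push h) e₁ e₂ e₃ e₄ _⟩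
  | @pushL_pushR _ _ _ _ _ _ f _ h _ _ _ e₁ e₂ e₃ e₄ α =>
    exact ⟨rfl, hswap (.push f) (.push h) e₁ e₂ e₃ e₄ _⟩
  | @pullL_pullR _ _ _ _ _ _ f _ h _ _ _ e₁ e₂ e₃ e₄ α =>
    exact ⟨rfl, hswap (.pull f) (.pull h) e₁ e₂ e₃ e₄ _⟩
  | @pushL_pullR _ _ _ _ _ _ f _ h _ _ _ e₁ e₂ e₃ e₄ α =>
    exact ⟨rfl, hswap (.push f) (.pull h) e₁ e₂ e₃ e₄ _⟩

end PermEq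

/-- `sw` lists swaps of adjacent rules: its values are sound on the codes of proofs, and complete
for the swaps of a right rule below a left rule. -/
structure SwapSpec (κ : Coding C) (sw : RuleCode × RuleCode →. List (RuleCode × RuleCode)) :
    Prop where
  same_side : ∀ r s : RuleCode, r.1 % 2 = s.1 % 2 → [] ∈ sw (r, s)
  right_left : ∀ {A A' B B' : C} {t : A ⟶ B} {m : A' ⟶ B} {c : A' ⟶ B'}
    (ρ : LeftRule C A A') (σ : RightRule C B B'), ρ.Valid t m → σ.Valid m c →
    ∃ L ∈ sw (σ.code κ m c, ρ.code κ t m), ∀ ab, ab ∈ L ↔ ∃ m' : A ⟶ B', σ.Valid t m' ∧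
      ρ.Valid m' c ∧ ab = (ρ.code κ m' c, σ.code κ t m')
  left_right : ∀ {A A' B B' : C} {t : A ⟶ B} {m' : A ⟶ B'} {c : A' ⟶ B'}
    (ρ : LeftRule C A A') (σ : RightRule C B B'), σ.Valid t m' → ρ.Valid m' c →
    ∃ L ∈ sw (ρ.code κ m' c, σ.code κ t m'), ∀ ab ∈ L, ∃ m : A' ⟶ B, ρ.Valid t m ∧
      σ.Valid m c ∧ ab = (σ.code κ m c, ρ.code κ t m)

/-- The names of left rules are even and those of right rules odd, which is how codes show the
side of a rule. -/
theorem LeftRule.code_fst_mod_two (κ : Coding C) {A B E : C} (ρ : LeftRule C A B) (g : A ⟶ E)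
    (g' : B ⟶ E) : (ρ.code κ g g').1 % 2 = 0 := by
  cases ρ <;> simp [code]

theorem RightRule.code_fst_mod_two (κ : Coding C) {A B E : C} (σ : RightRule C A B) (g : E ⟶ A)
    (g' : E ⟶ B) : (σ.code κ g g').1 % 2 = 1 := by
  cases σ <;> simp [code]

variable {κD : Coding D} {κC : Coding C}
  {sw : RuleCode × RuleCode →. List (RuleCode × RuleCode)}

theorem SwapSpec.dom (hsw : SwapSpec κC sw) {A B : C} {S : Frm p A} {T : Frm p B} {f : A ⟶ B}
    (α : Deriv p S T f) (u : List RuleCode) (r s : RuleCode) (l : List RuleCode)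
    (h : (α.code κD κC).2 = u ++ r :: s :: l) : (sw (r, s)).Dom := by
  induction α using Deriv.induction_sides generalizing u with
  | ax eX eY δ e => simp [Deriv.code] at h
  | left ρ v α ih =>
    rw [Deriv.code_left] at h
    cases u with
    | cons a u => exact ih u (List.cons.inj h).2
    | nil =>
      obtain ⟨hr, hs⟩ := List.cons.inj h
      subst hr
      clear h ih
      induction α using Deriv.induction_sides with
      | ax eX eY δ e => simp [Deriv.code] at hs
      | left ρ' v' α _ =>
        rw [Deriv.code_left] at hs
        obtain ⟨rfl, -⟩ := List.cons.inj hs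
        exact Part.dom_iff_mem.2 ⟨_, hsw.same_side _ _ (by simp [LeftRule.code_fst_mod_two])⟩
      | right σ v' α _ =>
        rw [Deriv.code_right] at hs
        obtain ⟨rfl, -⟩ := List.cons.inj hs
        obtain ⟨L, hL, -⟩ := hsw.left_right ρ σ v' v
        exact Part.dom_iff_mem.2 ⟨L, hL⟩
  | right σ v α ih =>
    rw [Deriv.code_right] at h
    cases u with
    | cons a u => exact ih u (List.cons.inj h).2
    | nil =>
      obtain ⟨hr, hs⟩ := List.cons.inj h
      subst hr
      clear h ih
      induction α using Deriv.induction_sides with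
      | ax eX eY δ e => simp [Deriv.code] at hs
      | left ρ v' α _ =>
        rw [Deriv.code_left] at hs
        obtain ⟨rfl, -⟩ := List.cons.inj hs
        obtain ⟨L, hL, -⟩ := hsw.right_left ρ σ v' v
        exact Part.dom_iff_mem.2 ⟨L, hL⟩
      | right σ v' α _ =>
        rw [Deriv.code_right] at hs
        obtain ⟨rfl, -⟩ := List.cons.inj hs
        exact Part.dom_iff_mem.2 ⟨_, hsw.same_side _ _ (by simp [RightRule.code_fst_mod_two])⟩

/-- Every step from the code of a proof is a permutation of that proof. -/
theorem SwapSpec.exists_permEq_of_step (hsw : SwapSpec κC sw) {A B : C} {S : Frm p A}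
    {T : Frm p B} {f : A ⟶ B} (α : Deriv p S T f) {l : List RuleCode}
    (h : Step sw (α.code κD κC).2 l) :
    ∃ β : Deriv p S T f, PermEq α β ∧ β.code κD κC = ((α.code κD κC).1, l) := by
  induction α using Deriv.induction_sides generalizing l with
  | ax eX eY δ e => exact nomatch h
  | left ρ v α ih =>
    rw [Deriv.code_left] at h
    generalize hl : (α.code κD κC).2 = l₀ at h ih
    cases h with
    | cons _ h =>
      obtain ⟨β, hβ, hc⟩ := ih h
      exact ⟨β.left ρ v, hβ.left ρ v, by simp [Deriv.code_left, hc]⟩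
    | swap l hL hab =>
      clear ih
      induction α using Deriv.induction_sides with
      | ax eX eY δ e => simp [Deriv.code] at hl
      | left ρ' v' α _ =>
        rw [Deriv.code_left] at hl
        obtain ⟨rfl, -⟩ := List.cons.inj hl
        cases Part.mem_unique hL
          (hsw.same_side _ _ (by simp [LeftRule.code_fst_mod_two])) ▸ hab
      | right σ v' α _ =>
        rw [Deriv.code_right] at hl
        obtain ⟨rfl, rfl⟩ := List.cons.inj hl
        obtain ⟨L, hL', h⟩ := hsw.left_right ρ σ v' v
        obtain ⟨m, h₁, h₂, he⟩ := h _ (Part.mem_unique hL hL' ▸ hab)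
        cases he
        exact ⟨(α.left ρ h₁).right σ h₂, .symm (.swap ρ σ h₁ h₂ v' v α),
          by simp [Deriv.code_left, Deriv.code_right]⟩
  | right σ v α ih =>
    rw [Deriv.code_right] at h
    generalize hl : (α.code κD κC).2 = l₀ at h ih
    cases h with
    | cons _ h =>
      obtain ⟨β, hβ, hc⟩ := ih h
      exact ⟨β.right σ v, hβ.right σ v, by simp [Deriv.code_right, hc]⟩
    | swap l hL hab =>
      clear ih
      induction α using Deriv.induction_sides with
      | ax eX eY δ e => simp [Deriv.code] at hl
      | right σ' v' α _ =>
        rw [Deriv.code_right] at hl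
        obtain ⟨rfl, -⟩ := List.cons.inj hl
        cases Part.mem_unique hL
          (hsw.same_side _ _ (by simp [RightRule.code_fst_mod_two])) ▸ hab
      | left ρ v' α _ =>
        rw [Deriv.code_left] at hl
        obtain ⟨rfl, rfl⟩ := List.cons.inj hl
        obtain ⟨L, hL', h⟩ := hsw.right_left ρ σ v' v
        obtain ⟨m, h₁, h₂, he⟩ := (h _).1 (Part.mem_unique hL hL' ▸ hab)
        cases he
        exact ⟨(α.right σ h₁).left ρ h₂, .swap ρ σ v' v h₁ h₂ α,
          by simp [Deriv.code_left, Deriv.code_right]⟩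

open Relation in
theorem SwapSpec.exists_permEq_of_steps (hsw : SwapSpec κC sw) {A B : C} {S : Frm p A}
    {T : Frm p B} {f : A ⟶ B} (α : Deriv p S T f) {l : List RuleCode}
    (h : ReflTransGen (Step sw) (α.code κD κC).2 l) :
    ∃ β : Deriv p S T f, PermEq α β ∧ β.code κD κC = ((α.code κD κC).1, l) := by
  induction h with
  | refl => exact ⟨α, .refl α, rfl⟩
  | tail _ h ih =>
    obtain ⟨β, hβ, hc⟩ := ih
    obtain ⟨γ, hγ, hc'⟩ := hsw.exists_permEq_of_step (κD := κD) β (by rw [hc]; exact h)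
    exact ⟨γ, hβ.trans hγ, by rw [hc', hc]⟩

end Sides

/-! ### Deciding permutation equivalence by saturation -/

section Decision

open Relation

variable {D : Type u₁} [Category.{v₁} D] {C : Type u₂} [Category.{v₂} C] {p : D ⥤ C}
  {κD : Coding D} {κC : Coding C} {sw : RuleCode × RuleCode →. List (RuleCode × RuleCode)}

/-- If the codes of equivalent proofs have a common reduct, and only finitely many lists can be
reached from the code of a proof, then permutation equivalence is decided by intersecting the
two sets of reducts. -/
theorem SwapSpec.exists_decision (hsw : SwapSpec κC sw) (hrec : Partrec sw)
    (hfin : ∀ l, {m | ReflTransGen (Step sw) l m}.Finite)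
    (hjoin : ∀ {A B : C} {S : Frm p A} {T : Frm p B} {f : A ⟶ B} {α β : Deriv p S T f},
      PermEq α β → (α.code κD κC).1 = (β.code κD κC).1 ∧
        Join (ReflTransGen (Step sw)) (α.code κD κC).2 (β.code κD κC).2) :
    ∃ dec : ProofCode × ProofCode →. Bool, Partrec dec ∧
      ∀ {A B : C} (S : Frm p A) (T : Frm p B) (f : A ⟶ B) (α₁ α₂ : Deriv p S T f),
        ∃ b : Bool, dec (α₁.code κD κC, α₂.code κD κC) = Part.some b ∧
          (b = true ↔ PermEq α₁ α₂) := by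
  classical
  let F := saturate (stepList sw)
  have hF : Partrec F := partrec_saturate (partrec_stepList hrec)
  refine ⟨fun w => (F w.1.2).bind fun R => (F w.2.2).map fun R' =>
    decide (w.1.1 = w.2.1 ∧ ∃ z ∈ R, z ∈ R'), ?_, ?_⟩
  · have htest : PrimrecPred fun x : ((ProofCode × ProofCode) × List (List RuleCode)) ×
        List (List RuleCode) => x.1.1.1.1 = x.1.1.2.1 ∧ ∃ z ∈ x.1.2, z ∈ x.2 := by
      refine PrimrecPred.and (Primrec.eq.comp ?_ ?_)
        (primrec_mem.exists_mem_list.comp (Primrec.snd.comp Primrec.fst) Primrec.snd)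
      · exact Primrec.fst.comp (Primrec.fst.comp (Primrec.fst.comp Primrec.fst))
      · exact Primrec.fst.comp (Primrec.snd.comp (Primrec.fst.comp Primrec.fst))
    refine Partrec.bind (hF.comp (Computable.snd.comp Computable.fst)) ?_
    refine Partrec.map (hF.comp (Computable.snd.comp (Computable.snd.comp Computable.fst))) ?_
    exact htest.decide.to_comp.of_eq fun _ => decide_eq_decide.2 Iff.rfl
  · intro A B S T f α₁ α₂
    have hdom : ∀ α : Deriv p S T f, (stepList sw (α.code κD κC).2).Dom :=
      fun α => stepList_dom fun u r s l h => hsw.dom α u r s l h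
    have hQ : ∀ l m, (∃ α : Deriv p S T f, (α.code κD κC).2 = l) → Step sw l m →
        ∃ α : Deriv p S T f, (α.code κD κC).2 = m := by
      rintro _ m ⟨α, rfl⟩ h
      obtain ⟨β, -, hβ⟩ := hsw.exists_permEq_of_step α h
      exact ⟨β, by rw [hβ]⟩
    have hsat : ∀ α : Deriv p S T f, ∃ R ∈ F (α.code κD κC).2,
        ∀ l, l ∈ R ↔ ReflTransGen (Step sw) (α.code κD κC).2 l := by
      intro α
      obtain ⟨R, hR, hmem⟩ := exists_mem_saturate (f := stepList sw)
        (Q := fun l => ∃ α : Deriv p S T f, (α.code κD κC).2 = l)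
        (by rintro _ ⟨α, rfl⟩; exact hdom α) (fun l m hl h => hQ l m hl (step_of_succ h))
        ⟨α, rfl⟩ ((hfin _).subset fun m => ReflTransGen.mono (fun _ _ => step_of_succ) _ m)
      refine ⟨R, hR, fun l => (hmem l).trans ⟨ReflTransGen.mono (fun _ _ => step_of_succ) _ l, ?_⟩⟩
      intro h
      suffices ReflTransGen (Succ (stepList sw)) (α.code κD κC).2 l ∧
        ∃ β : Deriv p S T f, (β.code κD κC).2 = l from this.1
      induction h with
      | refl => exact ⟨.refl, α, rfl⟩
      | tail _ h ih =>
        obtain ⟨ih, β, rfl⟩ := ih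
        exact ⟨ih.tail (succ_of_step (hdom β) h), hQ _ _ ⟨β, rfl⟩ h⟩
    obtain ⟨R₁, hR₁, h₁⟩ := hsat α₁
    obtain ⟨R₂, hR₂, h₂⟩ := hsat α₂
    refine ⟨_, Part.eq_some_iff.2 (Part.mem_bind hR₁ (Part.mem_map _ hR₂)), ?_⟩
    rw [decide_eq_true_eq]
    constructor
    · rintro ⟨hax, l, hl₁, hl₂⟩
      obtain ⟨β₁, hβ₁, hc₁⟩ := hsw.exists_permEq_of_steps α₁ ((h₁ l).1 hl₁)
      obtain ⟨β₂, hβ₂, hc₂⟩ := hsw.exists_permEq_of_steps α₂ ((h₂ l).1 hl₂)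
      obtain rfl := Deriv.code_injective κD κC β₁ β₂ (hc₁.trans (by rw [hc₂]; exact hax ▸ rfl))
      exact hβ₁.trans hβ₂.symm
    · intro h
      obtain ⟨hax, l, hl₁, hl₂⟩ := hjoin h
      exact ⟨hax, l, (h₁ l).2 hl₁, (h₂ l).2 hl₂⟩

end Decision

/-! ### Computing the swaps of two adjacent rules -/

section Swaps

variable {C : Type u₂} [Category.{v₂} C] {κ : Coding C}

/-- The equation that makes a rule instance valid, as a pair of arrows to be composed and the
code that their composite should have. -/
def ruleEquation (r : RuleCode) : (ArrowCode × ArrowCode) × ℕ :=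
  if r.1 = 0 then ((r.2.1, r.2.2.2), r.2.2.1.2.2)
  else if r.1 = 1 then ((r.2.2.1, r.2.1), r.2.2.2.2.2)
  else if r.1 = 2 then ((r.2.1, r.2.2.1), r.2.2.2.2.2)
  else ((r.2.2.2, r.2.1), r.2.2.1.2.2)

/-- Whether the rule instance with code `r` is valid, given a composition function `c`. -/
def ruleHolds (c : ArrowCode × ArrowCode →. ℕ) (r : RuleCode) : Part Bool :=
  (c (ruleEquation r).1).map fun n => decide (n = (ruleEquation r).2)

/-- The domain and codomain of the middle base arrow after a swap of two adjacent rules, given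
from the conclusion upwards. Right rules are the ones with odd names. -/
def newEnds (w : RuleCode × RuleCode) : ℕ × ℕ :=
  if w.1.1 % 2 = 1 then (w.2.2.2.1.1, w.1.2.2.2.2.1) else (w.1.2.2.2.1, w.2.2.2.1.2.1)

/-- Two adjacent rules after their swap, if the new middle base arrow has code `i`. -/
def swapAt (w : RuleCode × RuleCode) (i : ℕ) : RuleCode × RuleCode :=
  ((w.2.1, w.2.2.1, ((newEnds w).1, (newEnds w).2, i), w.1.2.2.2),
    (w.1.1, w.1.2.1, w.2.2.2.1, ((newEnds w).1, (newEnds w).2, i)))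

/-- Whether two rule instances are both valid. -/
def bothHold (c : ArrowCode × ArrowCode →. ℕ) (v : RuleCode × RuleCode) : Part Bool :=
  (ruleHolds c v.1).bind fun b => (ruleHolds c v.2).map fun b' => b && b'

/-- The valid swaps of two adjacent rules, where `cand` lists candidates for the code of the new
middle base arrow. -/
def swapsOf (c : ArrowCode × ArrowCode →. ℕ) (cand : RuleCode × RuleCode →. List ℕ)
    (w : RuleCode × RuleCode) : Part (List (RuleCode × RuleCode)) :=
  (cand w).bind fun L => partFilter (bothHold c) (L.map (swapAt w))

theorem primrec_ruleEquation : Primrec ruleEquation := by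
  have hA : Primrec fun r : RuleCode => r.2.1 := .comp .fst .snd
  have hD : Primrec fun r : RuleCode => r.2.2.1 := .comp .fst (.comp .snd .snd)
  have hE : Primrec fun r : RuleCode => r.2.2.2 := .comp .snd (.comp .snd .snd)
  have hhom : Primrec fun a : ArrowCode => a.2.2 := .comp .snd .snd
  have hn (n : ℕ) : PrimrecPred fun r : RuleCode => r.1 = n := Primrec.eq.comp .fst (.const n)
  exact Primrec.ite (hn 0) ((hA.pair hE).pair (hhom.comp hD)) <|
    Primrec.ite (hn 1) ((hD.pair hA).pair (hhom.comp hE)) <|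
    Primrec.ite (hn 2) ((hA.pair hD).pair (hhom.comp hE)) ((hE.pair hA).pair (hhom.comp hD))

theorem primrec_newEnds : Primrec newEnds := by
  have hD : Primrec fun w : RuleCode × RuleCode => w.2.2.2.1 :=
    .comp .fst (.comp .snd (.comp .snd .snd))
  have hE : Primrec fun w : RuleCode × RuleCode => w.1.2.2.2 :=
    .comp .snd (.comp .snd (.comp .snd .fst))
  have hcod : Primrec fun a : ArrowCode => a.2.1 := .comp .fst .snd
  have hdom : Primrec fun a : ArrowCode => a.1 := .fst
  have hn : PrimrecPred fun w : RuleCode × RuleCode => w.1.1 % 2 = 1 :=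
    Primrec.eq.comp (Primrec.nat_mod.comp (.comp .fst .fst) (.const 2)) (.const 1)
  exact Primrec.ite hn ((hdom.comp hD).pair (hcod.comp hE)) ((hdom.comp hE).pair (hcod.comp hD))

theorem primrec_swapAt : Primrec₂ swapAt := by
  have hw : Primrec fun x : (RuleCode × RuleCode) × ℕ => newEnds x.1 := primrec_newEnds.comp .fst
  have hm : Primrec fun x : (RuleCode × RuleCode) × ℕ =>
      (((newEnds x.1).1, (newEnds x.1).2, x.2) : ArrowCode) :=
    (Primrec.fst.comp hw).pair ((Primrec.snd.comp hw).pair .snd)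
  have hr : Primrec fun x : (RuleCode × RuleCode) × ℕ => x.1.1 := .comp .fst .fst
  have hs : Primrec fun x : (RuleCode × RuleCode) × ℕ => x.1.2 := .comp .snd .fst
  have hA : Primrec fun r : RuleCode => r.2.1 := .comp .fst .snd
  have hD : Primrec fun r : RuleCode => r.2.2.1 := .comp .fst (.comp .snd .snd)
  have hE : Primrec fun r : RuleCode => r.2.2.2 := .comp .snd (.comp .snd .snd)
  exact ((Primrec.fst.comp hs).pair ((hA.comp hs).pair (hm.pair (hE.comp hr)))).pair
    ((Primrec.fst.comp hr).pair ((hA.comp hr).pair ((hD.comp hs).pair hm)))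

theorem partrec_ruleHolds {c : ArrowCode × ArrowCode →. ℕ} (hc : Partrec c) :
    Partrec (ruleHolds c) :=
  Partrec.map (hc.comp (Primrec.fst.comp primrec_ruleEquation).to_comp)
    (Primrec.eq.decide.to_comp.comp Computable.snd
      ((Primrec.snd.comp primrec_ruleEquation).to_comp.comp Computable.fst))

theorem partrec_bothHold {c : ArrowCode × ArrowCode →. ℕ} (hc : Partrec c) :
    Partrec (bothHold c) :=
  Partrec.bind ((partrec_ruleHolds hc).comp Computable.fst)
    (Partrec.map ((partrec_ruleHolds hc).comp (Computable.snd.comp Computable.fst))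
      (Primrec.and.to_comp.comp (Computable.snd.comp Computable.fst) Computable.snd))

theorem true_mem_bothHold {c : ArrowCode × ArrowCode →. ℕ} {v : RuleCode × RuleCode} :
    true ∈ bothHold c v ↔ true ∈ ruleHolds c v.1 ∧ true ∈ ruleHolds c v.2 := by
  simp [bothHold, Part.mem_bind_iff]

theorem partrec_swapsOf {c : ArrowCode × ArrowCode →. ℕ} {cand : RuleCode × RuleCode →. List ℕ}
    (hc : Partrec c) (hcand : Partrec cand) : Partrec (swapsOf c cand) := by
  have hmap : Primrec fun x : (RuleCode × RuleCode) × List ℕ => x.2.map (swapAt x.1) :=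
    Primrec.list_map Primrec.snd (primrec_swapAt.comp₂ (Primrec.fst.comp₂ Primrec₂.left)
      Primrec₂.right)
  have hfilter := (partrec_partFilter (partrec_bothHold hc)).comp hmap.to_comp
  exact hcand.bind hfilter

theorem mem_of_mem_swapsOf {c : ArrowCode × ArrowCode →. ℕ}
    {cand : RuleCode × RuleCode →. List ℕ} {w : RuleCode × RuleCode} {L : List ℕ}
    {M : List (RuleCode × RuleCode)} (hL : L ∈ cand w) (hM : M ∈ swapsOf c cand w)
    (v : RuleCode × RuleCode) :
    v ∈ M ↔ ∃ i ∈ L, v = swapAt w i ∧ true ∈ ruleHolds c v.1 ∧ true ∈ ruleHolds c v.2 := by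
  obtain ⟨L', hL', hM⟩ := Part.mem_bind_iff.1 hM
  obtain rfl := Part.mem_unique hL hL'
  rw [mem_of_mem_partFilter hM, true_mem_bothHold, List.mem_map]
  constructor
  · rintro ⟨⟨i, hi, rfl⟩, h⟩
    exact ⟨i, hi, rfl, h⟩
  · rintro ⟨i, hi, rfl, h⟩
    exact ⟨⟨i, hi, rfl⟩, h⟩

theorem exists_mem_swapsOf {c : ArrowCode × ArrowCode →. ℕ}
    {cand : RuleCode × RuleCode →. List ℕ} {w : RuleCode × RuleCode} {L : List ℕ}
    (hL : L ∈ cand w)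
    (h : ∀ i ∈ L, (ruleHolds c (swapAt w i).1).Dom ∧ (ruleHolds c (swapAt w i).2).Dom) :
    ∃ M, M ∈ swapsOf c cand w := by
  obtain ⟨M, hM⟩ := exists_mem_partFilter (f := bothHold c) (l := L.map (swapAt w)) fun v hv => by
    obtain ⟨i, hi, rfl⟩ := List.mem_map.1 hv
    exact ⟨(h i hi).1, (h i hi).2⟩
  exact ⟨M, Part.mem_bind hL hM⟩

variable {A A' B B' : C}

theorem swapAt_right_left (ρ : LeftRule C A A') (σ : RightRule C B B') (t : A ⟶ B)
    (m : A' ⟶ B) (m' : A ⟶ B') (c : A' ⟶ B') :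
    swapAt (σ.code κ m c, ρ.code κ t m) (κ.hom m') = (ρ.code κ m' c, σ.code κ t m') := by
  cases ρ <;> cases σ <;>
    simp [swapAt, newEnds, LeftRule.code, RightRule.code, Coding.arrow]

theorem swapAt_left_right (ρ : LeftRule C A A') (σ : RightRule C B B') (t : A ⟶ B)
    (m : A' ⟶ B) (m' : A ⟶ B') (c : A' ⟶ B') :
    swapAt (ρ.code κ m' c, σ.code κ t m') (κ.hom m) = (σ.code κ m c, ρ.code κ t m) := by
  cases ρ <;> cases σ <;>
    simp [swapAt, newEnds, LeftRule.code, RightRule.code, Coding.arrow]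

/-- `c` sends the codes of composable arrows to the code of their composite. -/
def Composes (κ : Coding C) (c : ArrowCode × ArrowCode →. ℕ) : Prop :=
  ∀ ⦃A B E : C⦄ (f : A ⟶ B) (g : B ⟶ E),
    c (κ.arrow f, κ.arrow g) = Part.some (κ.hom (f ≫ g))

variable {c : ArrowCode × ArrowCode →. ℕ}

theorem hom_arrow (f : A ⟶ B) : (κ.arrow f).2.2 = κ.hom f := rfl

theorem LeftRule.ruleHolds_code (hc : Composes κ c) (ρ : LeftRule C A A') (g : A ⟶ B)
    (g' : A' ⟶ B) : ∃ b, ruleHolds c (ρ.code κ g g') = Part.some b ∧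
      (b = true ↔ ρ.Valid g g') := by
  cases ρ with
  | push f =>
    refine ⟨decide (κ.hom (f ≫ g') = κ.hom g), ?_, ?_⟩
    · simp [ruleHolds, ruleEquation, code, hc f g', hom_arrow]
    · simpa [Valid] using (κ.hom_injective A B).eq_iff
  | pull f =>
    refine ⟨decide (κ.hom (f ≫ g) = κ.hom g'), ?_, ?_⟩
    · simp [ruleHolds, ruleEquation, code, hc f g, hom_arrow]
    · simpa [Valid] using (κ.hom_injective A' B).eq_iff

theorem RightRule.ruleHolds_code (hc : Composes κ c) (σ : RightRule C B B') (g : A ⟶ B)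
    (g' : A ⟶ B') : ∃ b, ruleHolds c (σ.code κ g g') = Part.some b ∧
      (b = true ↔ σ.Valid g g') := by
  cases σ with
  | push f =>
    refine ⟨decide (κ.hom (g ≫ f) = κ.hom g'), ?_, ?_⟩
    · simp [ruleHolds, ruleEquation, code, hc g f, hom_arrow]
    · simpa [Valid] using (κ.hom_injective A B').eq_iff
  | pull f =>
    refine ⟨decide (κ.hom (g' ≫ f) = κ.hom g), ?_, ?_⟩
    · simp [ruleHolds, ruleEquation, code, hc g' f, hom_arrow]
    · simpa [Valid] using (κ.hom_injective A B).eq_iff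

/-- `cand` lists candidates for the new middle base arrow of a swap: on the codes of proofs its
values are codes of arrows with the right ends, and for a right rule below a left rule all swaps
are among the candidates. -/
structure CandSpec (κ : Coding C) (cand : RuleCode × RuleCode →. List ℕ) : Prop where
  same_side : ∀ r s : RuleCode, r.1 % 2 = s.1 % 2 → [] ∈ cand (r, s)
  right_left : ∀ {A A' B B' : C} {t : A ⟶ B} {m : A' ⟶ B} {c : A' ⟶ B'}
    (ρ : LeftRule C A A') (σ : RightRule C B B'), ρ.Valid t m → σ.Valid m c →
    ∃ L ∈ cand (σ.code κ m c, ρ.code κ t m), (∀ i ∈ L, ∃ m' : A ⟶ B', κ.hom m' = i) ∧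
      ∀ m' : A ⟶ B', σ.Valid t m' → ρ.Valid m' c → κ.hom m' ∈ L
  left_right : ∀ {A A' B B' : C} {t : A ⟶ B} {m' : A ⟶ B'} {c : A' ⟶ B'}
    (ρ : LeftRule C A A') (σ : RightRule C B B'), σ.Valid t m' → ρ.Valid m' c →
    ∃ L ∈ cand (ρ.code κ m' c, σ.code κ t m'), ∀ i ∈ L, ∃ m : A' ⟶ B, κ.hom m = i

theorem LeftRule.ruleHolds_dom (hc : Composes κ c) (ρ : LeftRule C A A') (g : A ⟶ B)
    (g' : A' ⟶ B) : (ruleHolds c (ρ.code κ g g')).Dom := by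
  obtain ⟨b, hb, -⟩ := ρ.ruleHolds_code hc g g'
  simp [hb]

theorem RightRule.ruleHolds_dom (hc : Composes κ c) (σ : RightRule C B B') (g : A ⟶ B)
    (g' : A ⟶ B') : (ruleHolds c (σ.code κ g g')).Dom := by
  obtain ⟨b, hb, -⟩ := σ.ruleHolds_code hc g g'
  simp [hb]

theorem LeftRule.true_mem_ruleHolds (hc : Composes κ c) (ρ : LeftRule C A A') (g : A ⟶ B)
    (g' : A' ⟶ B) : true ∈ ruleHolds c (ρ.code κ g g') ↔ ρ.Valid g g' := by
  obtain ⟨b, hb, h⟩ := ρ.ruleHolds_code hc g g'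
  rw [hb, Part.mem_some_iff, ← h, eq_comm]

theorem RightRule.true_mem_ruleHolds (hc : Composes κ c) (σ : RightRule C B B') (g : A ⟶ B)
    (g' : A ⟶ B') : true ∈ ruleHolds c (σ.code κ g g') ↔ σ.Valid g g' := by
  obtain ⟨b, hb, h⟩ := σ.ruleHolds_code hc g g'
  rw [hb, Part.mem_some_iff, ← h, eq_comm]

theorem CandSpec.mem_swaps_left_right {cand : RuleCode × RuleCode →. List ℕ}
    (hc : Composes κ c) {t : A ⟶ B} {m' : A ⟶ B'} {d : A' ⟶ B'} {L : List ℕ}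
    (ρ : LeftRule C A A') (σ : RightRule C B B')
    (hL : L ∈ cand (ρ.code κ m' d, σ.code κ t m')) (hLs : ∀ i ∈ L, ∃ m : A' ⟶ B, κ.hom m = i) :
    ∃ M ∈ swapsOf c cand (ρ.code κ m' d, σ.code κ t m'), ∀ ab, ab ∈ M ↔ ∃ m : A' ⟶ B,
      κ.hom m ∈ L ∧ ρ.Valid t m ∧ σ.Valid m d ∧ ab = (σ.code κ m d, ρ.code κ t m) := by
  obtain ⟨M, hM⟩ := exists_mem_swapsOf (c := c) hL fun i hi => by
    obtain ⟨m, rfl⟩ := hLs i hi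
    rw [swapAt_left_right]
    exact ⟨σ.ruleHolds_dom hc _ _, ρ.ruleHolds_dom hc _ _⟩
  refine ⟨M, hM, fun ab => (mem_of_mem_swapsOf hL hM ab).trans ⟨?_, ?_⟩⟩
  · rintro ⟨i, hi, rfl, h₁, h₂⟩
    obtain ⟨m, rfl⟩ := hLs i hi
    rw [swapAt_left_right] at *
    exact ⟨m, hi, (ρ.true_mem_ruleHolds hc _ _).1 h₂, (σ.true_mem_ruleHolds hc _ _).1 h₁, rfl⟩
  · rintro ⟨m, hm, h₁, h₂, rfl⟩
    exact ⟨_, hm, (swapAt_left_right ρ σ t m m' d).symm, (σ.true_mem_ruleHolds hc _ _).2 h₂,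
      (ρ.true_mem_ruleHolds hc _ _).2 h₁⟩

theorem CandSpec.swapSpec {cand : RuleCode × RuleCode →. List ℕ} (h : CandSpec κ cand)
    (hc : Composes κ c) : SwapSpec κ (swapsOf c cand) where
  same_side r s hrs := by
    have hL := h.same_side r s hrs
    obtain ⟨M, hM⟩ := exists_mem_swapsOf (c := c) hL (by simp)
    obtain rfl : M = [] := List.eq_nil_iff_forall_not_mem.2 fun v hv => by
      simpa using (mem_of_mem_swapsOf hL hM v).1 hv
    exact hM
  right_left {A A' B B' t m d} ρ σ h₁ h₂ := by
    obtain ⟨L, hL, hLs, hLc⟩ := h.right_left ρ σ h₁ h₂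
    obtain ⟨M, hM⟩ := exists_mem_swapsOf (c := c) hL fun i hi => by
      obtain ⟨m', rfl⟩ := hLs i hi
      rw [swapAt_right_left]
      exact ⟨ρ.ruleHolds_dom hc _ _, σ.ruleHolds_dom hc _ _⟩
    refine ⟨M, hM, fun ab => (mem_of_mem_swapsOf hL hM ab).trans ⟨?_, ?_⟩⟩
    · rintro ⟨i, hi, rfl, h₁, h₂⟩
      obtain ⟨m', rfl⟩ := hLs i hi
      rw [swapAt_right_left] at *
      exact ⟨m', (σ.true_mem_ruleHolds hc _ _).1 h₂, (ρ.true_mem_ruleHolds hc _ _).1 h₁, rfl⟩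
    · rintro ⟨m', h₁, h₂, rfl⟩
      exact ⟨_, hLc m' h₁ h₂, (swapAt_right_left ρ σ t m m' d).symm,
        (ρ.true_mem_ruleHolds hc _ _).2 h₂, (σ.true_mem_ruleHolds hc _ _).2 h₁⟩
  left_right ρ σ h₁ h₂ := by
    obtain ⟨L, hL, hLs⟩ := h.left_right ρ σ h₁ h₂
    obtain ⟨M, hM, h⟩ := mem_swaps_left_right hc ρ σ hL hLs
    refine ⟨M, hM, fun ab hab => ?_⟩
    obtain ⟨m, -, h⟩ := (h ab).1 hab
    exact ⟨m, h⟩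

end Swaps

/-! ### Rewriting that moves entries of one kind behind those of the other -/

section OneWay

open Relation

variable {ρ : Type*} {sw : ρ × ρ →. List (ρ × ρ)}

theorem reflTransGen_step_cons (r : ρ) {l m : List ρ} (h : ReflTransGen (Step sw) l m) :
    ReflTransGen (Step sw) (r :: l) (r :: m) :=
  h.lift (r :: ·) fun _ _ => Step.cons r

theorem finite_step (l : List ρ) : {m | Step sw l m}.Finite := by
  have hL : ∀ w : List ρ × (ρ × ρ) × List ρ, {L | L ∈ sw w.2.1}.Finite := fun w =>
    Set.Subsingleton.finite fun _ h _ h' => Part.mem_unique h h'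
  refine (Set.Finite.biUnion (List.finite_toSet (adjacentPairs l)) fun w _ =>
    (hL w).biUnion fun L _ => (List.finite_toSet L).image
      fun ab => w.1 ++ ab.1 :: ab.2 :: w.2.2).subset fun m hm => ?_
  obtain ⟨p, q, r, s, a, b, L, rfl, hL, hab, rfl⟩ := step_iff.1 hm
  simp only [Set.mem_iUnion]
  exact ⟨(p, (r, s), q), mem_adjacentPairs.2 rfl, L, hL, (a, b), hab, rfl⟩

/-- A terminating relation that is finitely branching has finite sets of reducts. -/
theorem finite_reflTransGen_of_measure {α : Type*} {r : α → α → Prop}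
    (hbr : ∀ x, {y | r x y}.Finite) (μ : α → ℕ) (hμ : ∀ x y, r x y → μ y < μ x) (x : α) :
    {y | ReflTransGen r x y}.Finite := by
  induction hn : μ x using Nat.strong_induction_on generalizing x with
  | _ n ih =>
    refine ((Set.finite_singleton x).union
      ((hbr x).biUnion fun y hy => ih (μ y) (hn ▸ hμ x y hy) y rfl)).subset fun z hz => ?_
    rcases ReflTransGen.cases_head hz with rfl | ⟨y, hxy, hyz⟩
    · exact .inl rfl
    · exact .inr (Set.mem_biUnion hxy hyz)

/-- The binary number, least significant digit first, whose digits say which entries of a list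
fail `P`. It drops when an entry that satisfies `P` moves behind one that does not. -/
def weight (P : ρ → Prop) [DecidablePred P] : List ρ → ℕ
  | [] => 0
  | r :: l => (if P r then 0 else 1) + 2 * weight P l

variable {P : ρ → Prop}
  (hP : ∀ r s L a b, L ∈ sw (r, s) → (a, b) ∈ L → P r ∧ ¬ P s ∧ ¬ P a ∧ P b)

include hP

theorem finite_reflTransGen_step (l : List ρ) : {m | ReflTransGen (Step sw) l m}.Finite := by
  classical
  refine finite_reflTransGen_of_measure finite_step (weight P) (fun l m h => ?_) l
  induction h with
  | swap l hL hab =>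
    obtain ⟨hr, hs, ha, hb⟩ := hP _ _ _ _ _ hL hab
    simp only [weight, hr, hs, ha, hb, if_true, if_false]
    omega
  | cons r _ ih =>
    simp only [weight]
    omega

/-- If only pairs whose first entry satisfies `P` and whose second does not can be swapped, and
in at most one way, then rewriting has the diamond property: distinct redexes are disjoint. -/
theorem step_diamond
    (hdet : ∀ w L v v', L ∈ sw w → v ∈ L → v' ∈ L → v = v') (l m n : List ρ)
    (hm : Step sw l m) (hn : Step sw l n) :
    ∃ k, ReflGen (Step sw) m k ∧ ReflTransGen (Step sw) n k := by
  induction hm generalizing n with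
  | swap l hL hab =>
    cases hn with
    | swap _ hL' hab' =>
      cases hdet _ _ _ _ hL hab (Part.mem_unique hL' hL ▸ hab')
      exact ⟨_, .refl, .refl⟩
    | cons _ hn =>
      cases hn with
      | swap _ hL' hab' => exact absurd (hP _ _ _ _ _ hL' hab').1 (hP _ _ _ _ _ hL hab).2.1
      | cons _ hn => exact ⟨_, .single (.cons _ (.cons _ hn)), .single (.swap _ hL hab)⟩
  | cons r hm ih =>
    cases hn with
    | swap _ hL hab =>
      cases hm with
      | swap _ hL' hab' => exact absurd (hP _ _ _ _ _ hL' hab').1 (hP _ _ _ _ _ hL hab).2.1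
      | cons _ hm => exact ⟨_, .single (.swap _ hL hab), .single (.cons _ (.cons _ hm))⟩
    | cons _ hn =>
      obtain ⟨k, hmk, hnk⟩ := ih _ hn
      refine ⟨r :: k, ?_, reflTransGen_step_cons r hnk⟩
      cases hmk with
      | refl => exact .refl
      | single h => exact .single (.cons r h)

end OneWay

/-! ### Computable homsets -/

section LocallyFinite

open Relation

variable {D : Type u₁} [Category.{v₁} D] {C : Type u₂} [Category.{v₂} C] {p : D ⥤ C}
  {κD : Coding D} {κC : Coding C}

/-- All arrows with the right ends are candidates for the new middle base arrow of a swap of a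
left rule and a right rule, in either order. -/
def homCandidates (e : ℕ × ℕ →. List ℕ) (w : RuleCode × RuleCode) : Part (List ℕ) :=
  cond (decide (w.1.1 % 2 = w.2.1 % 2)) (Part.some []) (e (newEnds w))

theorem partrec_homCandidates {e : ℕ × ℕ →. List ℕ} (he : Partrec e) :
    Partrec (homCandidates e) := by
  have hmod : Primrec fun r : RuleCode => r.1 % 2 := Primrec.nat_mod.comp .fst (.const 2)
  have hdec := (Primrec.eq (α := ℕ)).decide.comp (hmod.comp Primrec.fst) (hmod.comp Primrec.snd)
  exact Partrec.cond hdec.to_comp (Computable.const []).partrec (he.comp primrec_newEnds.to_comp)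

variable {A A' B B' : C}

theorem newEnds_right_left {κ : Coding C} (ρ : LeftRule C A A') (σ : RightRule C B B') (t : A ⟶ B)
    (m : A' ⟶ B) (c : A' ⟶ B') :
    newEnds (σ.code κ m c, ρ.code κ t m) = (κ.obj A, κ.obj B') := by
  cases ρ <;> cases σ <;> simp [newEnds, LeftRule.code, RightRule.code, Coding.arrow]

theorem newEnds_left_right {κ : Coding C} (ρ : LeftRule C A A') (σ : RightRule C B B') (t : A ⟶ B)
    (m' : A ⟶ B') (c : A' ⟶ B') :
    newEnds (ρ.code κ m' c, σ.code κ t m') = (κ.obj A', κ.obj B) := by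
  cases ρ <;> cases σ <;> simp [newEnds, LeftRule.code, RightRule.code, Coding.arrow]

/-- `e` lists the codes of the arrows between any two objects. -/
def ListsHoms (κ : Coding C) (e : ℕ × ℕ →. List ℕ) : Prop :=
  ∀ A B : C, ∃ l : List ℕ, e (κ.obj A, κ.obj B) = Part.some l ∧
    ∀ n : ℕ, n ∈ l ↔ ∃ f : A ⟶ B, κ.hom f = n

variable {c : ArrowCode × ArrowCode →. ℕ} {e : ℕ × ℕ →. List ℕ}

theorem exists_mem_homCandidates_right_left (he : ListsHoms κC e) (ρ : LeftRule C A A')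
    (σ : RightRule C B B') (t : A ⟶ B) (m : A' ⟶ B) (d : A' ⟶ B') :
    ∃ L ∈ homCandidates e (σ.code κC m d, ρ.code κC t m),
      ∀ n, n ∈ L ↔ ∃ m' : A ⟶ B', κC.hom m' = n := by
  obtain ⟨L, hL, h⟩ := he A B'
  refine ⟨L, ?_, h⟩
  simp [homCandidates, newEnds_right_left, LeftRule.code_fst_mod_two,
    RightRule.code_fst_mod_two, hL]

theorem exists_mem_homCandidates_left_right (he : ListsHoms κC e) (ρ : LeftRule C A A')
    (σ : RightRule C B B') (t : A ⟶ B) (m' : A ⟶ B') (d : A' ⟶ B') :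
    ∃ L ∈ homCandidates e (ρ.code κC m' d, σ.code κC t m'),
      ∀ n, n ∈ L ↔ ∃ m : A' ⟶ B, κC.hom m = n := by
  obtain ⟨L, hL, h⟩ := he A' B
  refine ⟨L, ?_, h⟩
  simp [homCandidates, newEnds_left_right, LeftRule.code_fst_mod_two,
    RightRule.code_fst_mod_two, hL]

theorem candSpec_homCandidates (he : ListsHoms κC e) : CandSpec κC (homCandidates e) where
  same_side r s h := by simp [homCandidates, h]
  right_left ρ σ _ _ := by
    obtain ⟨L, hL, h⟩ := exists_mem_homCandidates_right_left he ρ σ _ _ _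
    exact ⟨L, hL, fun i hi => (h i).1 hi, fun m' _ _ => (h _).2 ⟨m', rfl⟩⟩
  left_right ρ σ _ _ := by
    obtain ⟨L, hL, h⟩ := exists_mem_homCandidates_left_right he ρ σ _ _ _
    exact ⟨L, hL, fun i hi => (h i).1 hi⟩

/-- Swapping creates no new objects, so rewriting stays among the lists of a fixed length over
the finitely many rule codes whose base arrows are listed by `e` or present at the start. -/
theorem finite_reflTransGen_step_homCandidates (l₀ : List RuleCode) :
    {m | ReflTransGen (Step (swapsOf c (homCandidates e))) l₀ m}.Finite := by
  let O : Set ℕ := {n | ∃ r ∈ l₀,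
    n ∈ [r.2.2.1.1, r.2.2.1.2.1, r.2.2.2.1, r.2.2.2.2.1]}
  let K₀ : Set ArrowCode := {a | ∃ r ∈ l₀, a ∈ [r.2.2.1, r.2.2.2]}
  let K : Set ArrowCode :=
    {a | a.1 ∈ O ∧ a.2.1 ∈ O ∧ ∃ L ∈ e (a.1, a.2.1), a.2.2 ∈ L} ∪ K₀
  let W : Set RuleCode := {r | (∃ s ∈ l₀, (r.1, r.2.1) = (s.1, s.2.1)) ∧ r.2.2.1 ∈ K ∧ r.2.2.2 ∈ K}
  have hO : O.Finite := by
    refine ((List.finite_toSet l₀).biUnion fun r _ => List.finite_toSet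
      [r.2.2.1.1, r.2.2.1.2.1, r.2.2.2.1, r.2.2.2.2.1]).subset fun n hn => ?_
    obtain ⟨r, hr, hn⟩ := hn
    exact Set.mem_biUnion hr hn
  have hK₀ : K₀.Finite := by
    refine ((List.finite_toSet l₀).biUnion fun r _ => List.finite_toSet
      [r.2.2.1, r.2.2.2]).subset fun n hn => ?_
    obtain ⟨r, hr, hn⟩ := hn
    exact Set.mem_biUnion hr hn
  have hK : K.Finite := by
    refine Set.Finite.union ?_ hK₀
    have hL : ∀ x : ℕ × ℕ, {L | L ∈ e x}.Finite := fun x =>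
      Set.Subsingleton.finite fun _ h _ h' => Part.mem_unique h h'
    refine ((hO.prod hO).biUnion fun x _ => (hL x).biUnion fun L _ =>
      (List.finite_toSet L).image fun i => ((x.1, x.2, i) : ArrowCode)).subset ?_
    rintro ⟨a, b, i⟩ ⟨ha, hb, L, hL, hi⟩
    simp only [Set.mem_iUnion]
    exact ⟨(a, b), ⟨ha, hb⟩, L, hL, i, hi, rfl⟩
  have hW : W.Finite := by
    refine (((List.finite_toSet l₀).image fun s => (s.1, s.2.1)).prod (hK.prod hK)).preimage
      (f := fun r : RuleCode => ((r.1, r.2.1), r.2.2)) (Set.injOn_of_injective ?_) |>.subset ?_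
    · rintro ⟨n, a, r⟩ ⟨n', a', r'⟩ h
      simpa [and_assoc] using h
    · rintro r ⟨⟨s, hs, h⟩, h₁, h₂⟩
      exact ⟨⟨s, hs, h.symm⟩, h₁, h₂⟩
  have hKO : ∀ a ∈ K, a.1 ∈ O ∧ a.2.1 ∈ O := by
    rintro a (⟨h₁, h₂, -⟩ | ⟨r, hr, ha⟩)
    · exact ⟨h₁, h₂⟩
    · rcases List.mem_pair.1 ha with rfl | rfl
      · exact ⟨⟨r, hr, by simp⟩, ⟨r, hr, by simp⟩⟩
      · exact ⟨⟨r, hr, by simp⟩, ⟨r, hr, by simp⟩⟩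
  have hends : ∀ w : RuleCode × RuleCode, w.1 ∈ W → w.2 ∈ W →
      (newEnds w).1 ∈ O ∧ (newEnds w).2 ∈ O := by
    intro w h₁ h₂
    unfold newEnds
    split_ifs
    · exact ⟨(hKO _ h₂.2.1).1, (hKO _ h₁.2.2).2⟩
    · exact ⟨(hKO _ h₁.2.2).1, (hKO _ h₂.2.1).2⟩
  have hswap : ∀ w M v, M ∈ swapsOf c (homCandidates e) w → v ∈ M → w.1 ∈ W → w.2 ∈ W →
      v.1 ∈ W ∧ v.2 ∈ W := by
    intro w M v hM hv h₁ h₂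
    obtain ⟨L, hL, -⟩ := Part.mem_bind_iff.1 hM
    obtain ⟨i, hi, rfl, -⟩ := (mem_of_mem_swapsOf hL hM v).1 hv
    have hmid : ((newEnds w).1, (newEnds w).2, i) ∈ K := by
      refine .inl ⟨(hends w h₁ h₂).1, (hends w h₁ h₂).2, L, ?_, hi⟩
      unfold homCandidates at hL
      cases hd : decide (w.1.1 % 2 = w.2.1 % 2) with
      | false => simpa [hd] using hL
      | true =>
        obtain rfl : L = [] := by simpa [hd] using hL
        simp at hi
    exact ⟨⟨h₂.1, hmid, h₁.2.2⟩, ⟨h₁.1, h₂.2.1, hmid⟩⟩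
  have hlists : {l : List RuleCode | l.length = l₀.length ∧ ∀ r ∈ l, r ∈ W}.Finite := by
    have := hW.to_subtype
    refine ((List.finite_length_eq W l₀.length).image (List.map Subtype.val)).subset ?_
    rintro l ⟨hl, hr⟩
    exact ⟨l.attachWith _ hr, by simpa using hl, List.attachWith_map_subtype_val hr⟩
  refine hlists.subset fun m hm => ?_
  induction hm with
  | refl =>
    exact ⟨rfl, fun r hr => ⟨⟨r, hr, rfl⟩, .inr ⟨r, hr, by simp⟩, .inr ⟨r, hr, by simp⟩⟩⟩
  | tail _ h ih =>
    obtain ⟨u, q, r, s, a, b, M, rfl, hM, hab, rfl⟩ := step_iff.1 h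
    obtain ⟨hlen, hmem⟩ := ih
    obtain ⟨ha, hb⟩ := hswap _ _ _ hM hab (hmem r (by simp)) (hmem s (by simp))
    refine ⟨by simpa using hlen, fun x hx => ?_⟩
    simp only [List.mem_append, List.mem_cons] at hx hmem
    rcases hx with hx | rfl | rfl | hx
    · exact hmem x (.inl hx)
    · exact ha
    · exact hb
    · exact hmem x (.inr (.inr (.inr hx)))

/-- When all arrows are candidates, rewriting is symmetric on the codes of proofs, so equivalent
proofs rewrite to each other. -/
theorem join_of_permEq_homCandidates (hc : Composes κC c) (he : ListsHoms κC e)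
    {S : Frm p A} {T : Frm p B} {f : A ⟶ B} {α β : Deriv p S T f} (h : PermEq α β) :
    (α.code κD κC).1 = (β.code κD κC).1 ∧
      Join (ReflTransGen (Step (swapsOf c (homCandidates e))))
        (α.code κD κC).2 (β.code κD κC).2 := by
  have key := PermEq.rel_code (κD := κD) (κC := κC)
    (R := fun l m => ReflTransGen (Step (swapsOf c (homCandidates e))) l m ∧
      ReflTransGen (Step (swapsOf c (homCandidates e))) m l)
    ⟨fun _ => ⟨.refl, .refl⟩, fun h => h.symm, fun h h' => ⟨h.1.trans h'.1, h'.2.trans h.2⟩⟩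
    (fun r _ _ h => ⟨reflTransGen_step_cons r h.1, reflTransGen_step_cons r h.2⟩)
    (fun {A A' B B' t m m' d} ρ σ h₁ h₂ h₃ h₄ l => by
      constructor
      · obtain ⟨M, hM, h⟩ := ((candSpec_homCandidates he).swapSpec hc).right_left ρ σ h₁ h₂
        exact .single (.swap l hM ((h _).2 ⟨m', h₃, h₄, rfl⟩))
      · obtain ⟨L, hL, hLs⟩ := exists_mem_homCandidates_left_right he ρ σ t m' d
        obtain ⟨M, hM, h⟩ := CandSpec.mem_swaps_left_right hc ρ σ hL fun i hi => (hLs i).1 hi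
        exact .single (.swap l hM ((h _).2 ⟨m, (hLs _).2 ⟨m, rfl⟩, h₁, h₂, rfl⟩))) h
  exact ⟨key.1, _, key.2.1, .refl⟩

end LocallyFinite

/-! ### Computable fillers in a factorization preordered category -/

section FactorizationPreordered

open Relation

variable {D : Type u₁} [Category.{v₁} D] {C : Type u₂} [Category.{v₂} C] {p : D ⥤ C}
  {κD : Coding D} {κC : Coding C}

/-- The candidate for the new middle base arrow of a swap of a right rule below a left rule: the
composite of the premise with a pushing right rule, or of a pushing left rule with the
conclusion; for two pull rules, the diagonal filler, if there is one. Pairs in the other order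
have no candidates. -/
def fillerCandidates (c : ArrowCode × ArrowCode →. ℕ)
    (d : ArrowCode × ArrowCode × ArrowCode × ArrowCode →. Option ℕ) (w : RuleCode × RuleCode) :
    Part (List ℕ) :=
  cond (decide (w.1.1 % 2 = 1 ∧ w.2.1 % 2 = 0))
    (cond (decide (w.1.1 = 1)) ((c (w.2.2.2.1, w.1.2.1)).map ([·]))
      (cond (decide (w.2.1 = 0)) ((c (w.2.2.1, w.1.2.2.2)).map ([·]))
        ((d (w.2.2.1, w.1.2.2.2, w.2.2.2.1, w.1.2.1)).map Option.toList)))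
    (Part.some [])

variable {c : ArrowCode × ArrowCode →. ℕ}
  {d : ArrowCode × ArrowCode × ArrowCode × ArrowCode →. Option ℕ}

theorem partrec_fillerCandidates (hc : Partrec c) (hd : Partrec d) :
    Partrec (fillerCandidates c d) := by
  have hr : Primrec fun w : RuleCode × RuleCode => w.1.1 := .comp .fst .fst
  have hs : Primrec fun w : RuleCode × RuleCode => w.2.1 := .comp .fst .snd
  have ha : Primrec fun w : RuleCode × RuleCode => w.1.2.1 := .comp .fst (.comp .snd .fst)
  have ha' : Primrec fun w : RuleCode × RuleCode => w.2.2.1 := .comp .fst (.comp .snd .snd)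
  have ht : Primrec fun w : RuleCode × RuleCode => w.2.2.2.1 :=
    .comp .fst (.comp .snd (.comp .snd .snd))
  have hx : Primrec fun w : RuleCode × RuleCode => w.1.2.2.2 :=
    .comp .snd (.comp .snd (.comp .snd .fst))
  have hp₀ : PrimrecPred fun w : RuleCode × RuleCode => w.1.1 % 2 = 1 ∧ w.2.1 % 2 = 0 :=
    (Primrec.eq.comp (Primrec.nat_mod.comp hr (.const 2)) (.const 1)).and
      (Primrec.eq.comp (Primrec.nat_mod.comp hs (.const 2)) (.const 0))
  have hp₁ : PrimrecPred fun w : RuleCode × RuleCode => w.1.1 = 1 :=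
    Primrec.eq.comp hr (.const 1)
  have hp₂ : PrimrecPred fun w : RuleCode × RuleCode => w.2.1 = 0 :=
    Primrec.eq.comp hs (.const 0)
  have hsing : Computable₂ fun (_ : RuleCode × RuleCode) (n : ℕ) => [n] :=
    Computable.list_cons.comp Computable.snd (Computable.const [])
  have hopt : Computable₂ fun (_ : RuleCode × RuleCode) (o : Option ℕ) => o.toList :=
    (Primrec.optionToList.comp Primrec.snd).to_comp
  have h₁ := Partrec.map (hc.comp (ht.pair ha).to_comp) hsing
  have h₂ := Partrec.map (hc.comp (ha'.pair hx).to_comp) hsing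
  have h₃ := Partrec.map (hd.comp (ha'.pair (hx.pair (ht.pair ha))).to_comp) hopt
  exact Partrec.cond hp₀.decide.to_comp (Partrec.cond hp₁.decide.to_comp h₁
    (Partrec.cond hp₂.decide.to_comp h₂ h₃)) (Computable.const []).partrec

/-- `d` decides whether a commuting square has a diagonal filler, and finds one. -/
def FindsFillers (κ : Coding C)
    (d : ArrowCode × ArrowCode × ArrowCode × ArrowCode →. Option ℕ) : Prop :=
  ∀ ⦃A B E F : C⦄ (f : A ⟶ B) (x : A ⟶ E) (y : B ⟶ F) (k : E ⟶ F), x ≫ k = f ≫ y →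
    (∃ l : B ⟶ E, f ≫ l = x ∧ l ≫ k = y ∧
      d (κ.arrow f, κ.arrow x, κ.arrow y, κ.arrow k) = Part.some (some (κ.hom l))) ∨
    ((¬ ∃ l : B ⟶ E, f ≫ l = x ∧ l ≫ k = y) ∧
      d (κ.arrow f, κ.arrow x, κ.arrow y, κ.arrow k) = Part.some none)

theorem candSpec_fillerCandidates (hC : FactorizationPreordered C) (hc : Composes κC c)
    (hd : FindsFillers κC d) : CandSpec κC (fillerCandidates c d) where
  same_side r s h := by
    have : ¬ (r.1 % 2 = 1 ∧ s.1 % 2 = 0) := by omega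
    simp [fillerCandidates, this]
  left_right ρ σ _ _ :=
    ⟨[], by simp [fillerCandidates, LeftRule.code_fst_mod_two], by simp⟩
  right_left {A A' B B' t m x} ρ σ h₁ h₂ := by
    cases σ with
    | push h =>
      refine ⟨[κC.hom (t ≫ h)], ?_, ?_, ?_⟩
      · simp [fillerCandidates, LeftRule.code_fst_mod_two, RightRule.code]
        cases ρ <;> simp [LeftRule.code, hc t h]
      · simp
      · rintro _ rfl _
        simp
    | pull h =>
      cases ρ with
      | push f =>
        refine ⟨[κC.hom (f ≫ x)], ?_, ?_, ?_⟩
        · simp [fillerCandidates, LeftRule.code, RightRule.code, hc f x]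
        · simp
        · rintro _ _ rfl
          simp
      | pull f =>
        have hsq : x ≫ h = f ≫ t := by
          change x ≫ h = m at h₂
          change f ≫ t = m at h₁
          rw [h₂, h₁]
        rcases hd f x t h hsq with ⟨l, hl₁, hl₂, hl⟩ | ⟨hno, hl⟩
        · refine ⟨[κC.hom l], ?_, ?_, ?_⟩
          · simp [fillerCandidates, LeftRule.code, RightRule.code, hl]
          · simp
          · intro l' hl'₂ hl'₁
            change l' ≫ h = t at hl'₂
            change f ≫ l' = x at hl'₁
            -- Fillers are unique in a factorization preordered category.
            rw [hC f l' l h (hl'₁.trans hl₁.symm) (hl'₂.trans hl₂.symm)]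
            simp
        · refine ⟨[], ?_, by simp, fun l' hl'₂ hl'₁ => (hno ⟨l', hl'₁, hl'₂⟩).elim⟩
          simp [fillerCandidates, LeftRule.code, RightRule.code, hl]

theorem fillerCandidates_spec {w : RuleCode × RuleCode} {L : List ℕ}
    (hL : L ∈ fillerCandidates c d w) :
    (L = [] ∨ w.1.1 % 2 = 1 ∧ w.2.1 % 2 = 0) ∧ ∀ i ∈ L, ∀ j ∈ L, i = j := by
  unfold fillerCandidates at hL
  by_cases h : w.1.1 % 2 = 1 ∧ w.2.1 % 2 = 0
  · refine ⟨.inr h, ?_⟩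
    rw [decide_eq_true h, cond_true] at hL
    cases h₁ : decide (w.1.1 = 1) <;> cases h₂ : decide (w.2.1 = 0) <;>
      simp only [h₁, h₂, cond_true, cond_false, Part.mem_map_iff] at hL <;>
      obtain ⟨o, -, rfl⟩ := hL <;> first
        | (simp; done)
        | exact fun i hi j hj => Option.some.inj
            ((Option.mem_toList.1 hi).symm.trans (Option.mem_toList.1 hj))
  · obtain rfl : L = [] := by simpa [h] using hL
    simp

theorem swapsOf_fillerCandidates_sides (r s : RuleCode) (L : List (RuleCode × RuleCode))
    (a b : RuleCode) (hL : L ∈ swapsOf c (fillerCandidates c d) (r, s)) (hab : (a, b) ∈ L) :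
    r.1 % 2 = 1 ∧ ¬ s.1 % 2 = 1 ∧ ¬ a.1 % 2 = 1 ∧ b.1 % 2 = 1 := by
  obtain ⟨M, hM, -⟩ := Part.mem_bind_iff.1 hL
  obtain ⟨i, hi, h, -⟩ := (mem_of_mem_swapsOf hM hL _).1 hab
  have hrs := (fillerCandidates_spec hM).1.resolve_left (List.ne_nil_of_mem hi)
  simp only [swapAt, Prod.mk.injEq] at h
  rw [h.1, h.2]
  simp only at hrs ⊢
  omega

theorem swapsOf_fillerCandidates_unique (w : RuleCode × RuleCode)
    (L : List (RuleCode × RuleCode)) (v v' : RuleCode × RuleCode)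
    (hL : L ∈ swapsOf c (fillerCandidates c d) w) (hv : v ∈ L) (hv' : v' ∈ L) : v = v' := by
  obtain ⟨M, hM, -⟩ := Part.mem_bind_iff.1 hL
  obtain ⟨i, hi, h, -⟩ := (mem_of_mem_swapsOf hM hL _).1 hv
  obtain ⟨j, hj, h', -⟩ := (mem_of_mem_swapsOf hM hL _).1 hv'
  rw [h, h', (fillerCandidates_spec hM).2 i hi j hj]

/-- The equivalence relation generated by a confluent relation is joinability. -/
theorem join_of_permEq_fillerCandidates (hC : FactorizationPreordered C) (hc : Composes κC c)
    (hd : FindsFillers κC d) {A B : C} {S : Frm p A} {T : Frm p B} {f : A ⟶ B}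
    {α β : Deriv p S T f} (h : PermEq α β) :
    (α.code κD κC).1 = (β.code κD κC).1 ∧
      Join (ReflTransGen (Step (swapsOf c (fillerCandidates c d))))
        (α.code κD κC).2 (β.code κD κC).2 := by
  refine PermEq.rel_code (equivalence_join_reflTransGen
    (step_diamond (P := fun r : RuleCode => r.1 % 2 = 1) swapsOf_fillerCandidates_sides
      swapsOf_fillerCandidates_unique)) ?_ ?_ h
  · rintro r l m ⟨k, hl, hm⟩
    exact ⟨r :: k, reflTransGen_step_cons r hl, reflTransGen_step_cons r hm⟩
  · intro A A' B B' t m m' x ρ σ h₁ h₂ h₃ h₄ l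
    obtain ⟨M, hM, h⟩ := ((candSpec_fillerCandidates hC hc hd).swapSpec hc).right_left ρ σ h₁ h₂
    exact ⟨_, .single (.swap l hM ((h _).2 ⟨m', h₃, h₄, rfl⟩)), .refl⟩

end FactorizationPreordered

end Bifibrational


theorem mainTheorem4 {D : Type u₁} [Category.{v₁} D] {C : Type u₂}
    [Category.{v₂} C] (p : D ⥤ C)
    (κD : Bifibrational.Coding D) (κC : Bifibrational.Coding C)
    (hcomp : κC.ComputableComp)
    (hC : (Bifibrational.LocallyFinite C ∧ κC.ComputableHomsets) ∨
      (Bifibrational.FactorizationPreordered C ∧ κC.ComputableFillers)) :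
    ∃ dec : Bifibrational.ProofCode × Bifibrational.ProofCode →. Bool, Partrec dec ∧
      ∀ {A B : C} (S : Bifibrational.Frm p A) (T : Bifibrational.Frm p B) (f : A ⟶ B)
        (α₁ α₂ : Bifibrational.Deriv p S T f),
        ∃ b : Bool, dec (α₁.code κD κC, α₂.code κD κC) = Part.some b ∧
          (b = true ↔ Bifibrational.PermEq α₁ α₂) := by
  obtain ⟨c, hcrec, hc⟩ := hcomp
  rcases hC with ⟨-, e, herec, he⟩ | ⟨hC, d, hdrec, hd⟩
  · exact ((Bifibrational.candSpec_homCandidates he).swapSpec hc).exists_decision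
      (Bifibrational.partrec_swapsOf hcrec (Bifibrational.partrec_homCandidates herec))
      Bifibrational.finite_reflTransGen_step_homCandidates
      (Bifibrational.join_of_permEq_homCandidates hc he)
  · exact ((Bifibrational.candSpec_fillerCandidates hC hc hd).swapSpec hc).exists_decision
      (Bifibrational.partrec_swapsOf hcrec (Bifibrational.partrec_fillerCandidates hcrec hdrec))
      (Bifibrational.finite_reflTransGen_step Bifibrational.swapsOf_fillerCandidates_sides)
      (Bifibrational.join_of_permEq_fillerCandidates hC hc hd)
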